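/- **Oriented modular graphs.** A connected undirected graph $\Gamma$ (finite or infinite), with shortest path metric $d$, is *modular* if any three vertices $x_1,x_2,x_3$ have a median, i.e. a vertex $m$ with $d(x_i,x_j)=d(x_i,m)+d(m,x_j)$ for $1\le i<j\le 3$. An *admissible orientation* of $\Gamma$ is an orientation of its edges such that in every 4-cycle $(x_1,x_2,x_3,x_4)$ one has $x_1\to x_2$ if and only if $x_4\to x_3$. Such an orientation is acyclic, and $\Gamma$ is regarded as a poset, where $x\to y$ is read as $y\preceq x$ and $\preceq$ is the reflexive-transitive closure. For a vertex $x$ put $I_x=\{y: y\preceq x\}$ and $F_x=\{y : x\preceq y\}$; with the minimum element $x$ (so $I_x$ carries the reversed order) both are modular semilattices. $\Gamma$ is *well-oriented* if every interval $[p,q]$ is a complemented modular lattice, i.e. every element of $[p,q]$ is a join of rank-1 elements of $[p,q]$. **Submodularity.** Let $L$ be a modular semilattice with rank function $r$. For $p,q\in L$ let $I(p,q)$ be the set of all existing joins $a\vee b$ with $p\wedge q\preceq a\preceq p$ and $p\wedge q\preceq b\preceq q$; for $u\in I(p,q)$ let $r(u;p,q)=(r(u\wedge p)-r(p\wedge q),\,r(u\wedge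 q)-r(p\wedge q))\in\mathbb R^2$; let $\operatorname{Conv}I(p,q)$ be the convex hull of these vectors; and let $E(p,q)$ be the set of $u\in I(p,q)$ such that $r(u;p,q)$ is a maximal extreme point of $\operatorname{Conv}I(p,q)$ (with respect to the componentwise order). For $u\in E(p,q)$ let $C(u;p,q)=\{c\in\mathbb R_{\ge0}^2:\langle c,r(u;p,q)\rangle=\max_{x\in\operatorname{Conv}I(p,q)}\langle c,x\rangle\}$. For the cone $C$ of vectors in $\mathbb R^2_{\ge 0}$ whose angle with the first axis lies in $[\beta,\alpha]$, where $0\le\beta\le\alpha\le\pi/2$, put $[C]=\frac{\sin\alpha}{\sin\alpha+\cos\alpha}-\frac{\sin\beta}{\sin\beta+\cos\beta}$. A function $f:L\to\mathbb R\cup\{\infty\}$ is *submodular* if $$f(p)+f(q)\ \ge\ f(p\wedge q)+\sum_{u\in E(p,q)}[C(u;p,q)]\,f(u)\qquad(p,q\in L).$$ **L-convexity.** Let $\Gamma$ be a well-oriented modular graph. A function $g:\Gamma\to\mathbb R\cup\{\infty\}$ is *L-convex* if it is submodular on $I_x$ and on $F_x$ for every vertex $x$, and any two elements of $\operatorname{dom}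 g=\{x: g(x)<\infty\}$ are joined by a finite sequence in $\operatorname{dom}g$ in which consecutive elements are comparable. Let $\operatorname{opt}(g)$ be the set of minimizers of $g$ over $\Gamma$. Let $\Gamma^\Delta$ be the graph obtained from $\Gamma$ by adding an edge $pq$ for all distinct $p,q$ for which both $p\wedge q$ and $p\vee q$ exist in $\Gamma$, let $d_\Delta$ be its shortest path metric, and let $d_\Delta(x,\operatorname{opt}(g))=\min\{d_\Delta(x,y): y\in\operatorname{opt}(g)\}$. **Steepest descent algorithm.** At the current point $x$, find a minimizer $y$ of $g$ over $I_x\cup F_x$ (ties are broken arbitrarily). If $g(y)=g(x)$, output $x$ and stop; otherwise replace $x$ by $y$ and repeat. Each such replacement of the current point is counted as one iteration. **Theorem.** Let $g$ be an L-convex function on a well-oriented modular graph $\Gamma$ with $\operatorname{opt}(g)\ne\emptyset$, and let $x\in\operatorname{dom}g$. Then, in every run of the steepest descent algorithm applied to $g$ with initial point $x$, the number of iterations is at most $d_\Delta(x,\operatorname{opt}(g))+2$. -/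

import Mathlib

/-!# L-convex functions on well-oriented modular graphs
-/

namespace LConvex

/-! ## Oriented modular graphs and their partial orders -/

/-- `m` is a median of `x`, `y`, `z` in the graph `G`. -/
def IsMedian {V : Type*} (G : SimpleGraph V) (x y z m : V) : Prop :=
  G.dist x y = G.dist x m + G.dist m y ∧
  G.dist y z = G.dist y m + G.dist m z ∧
  G.dist x z = G.dist x m + G.dist m z

/-- A modular graph: a connected graph in which every triple of vertices has a median. -/
structure IsModularGraph {V : Type*} (G : SimpleGraph V) : Prop where
  connected : G.Connected
  exists_median : ∀ x y z : V, ∃ m : V, IsMedian G x y z m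

/-- `arc x y`, read `x → y`, chooses exactly one direction for each edge of `G`. -/
structure IsOrientation {V : Type*} (G : SimpleGraph V) (arc : V → V → Prop) : Prop where
  adj_iff : ∀ x y : V, G.Adj x y ↔ arc x y ∨ arc y x
  asymm : ∀ x y : V, arc x y → ¬ arc y x

/-- An admissible orientation: in every 4-cycle `(x₁, x₂, x₃, x₄)`, `x₁ → x₂` iff `x₄ → x₃`. -/
structure IsAdmissibleOrientation {V : Type*} (G : SimpleGraph V) (arc : V → V → Prop) : Prop
    extends IsOrientation G arc where
  square : ∀ x₁ x₂ x₃ x₄ : V, G.Adj x₁ x₂ → G.Adj x₂ x₃ → G.Adj x₃ x₄ → G.Adj x₄ x₁ →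
    x₁ ≠ x₃ → x₂ ≠ x₄ → (arc x₁ x₂ ↔ arc x₄ x₃)

/-- An oriented modular graph on the vertex set `V`: a modular graph together with an
admissible orientation. -/
class OrientedModularGraph (V : Type*) where
  graph : SimpleGraph V
  arc : V → V → Prop
  modular : IsModularGraph graph
  admissible : IsAdmissibleOrientation graph arc

namespace OrientedModularGraph

variable {V : Type*} [OrientedModularGraph V]

/-- A modular graph is bipartite: adjacent vertices have distinct distances to any vertex. -/
theorem dist_ne_of_adj {x y : V} (h : (graph (V := V)).Adj x y) (z : V) :
    (graph (V := V)).dist z x ≠ (graph (V := V)).dist z y := by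
  have hc := (modular (V := V)).connected
  have h1 := SimpleGraph.dist_eq_one_iff_adj.2 h
  intro he
  obtain ⟨m, e1, e2, e3⟩ := (modular (V := V)).exists_median z x y
  rw [h1] at e2
  have c1 := SimpleGraph.dist_comm (G := graph (V := V)) (u := m) (v := x)
  omega

/-- A directed walk is a shortest path. -/
theorem dist_of_directed (n : ℕ) : ∀ p : ℕ → V, (∀ i < n, arc (p i) (p (i + 1))) →
    (graph (V := V)).dist (p 0) (p n) = n := by
  have hc := (modular (V := V)).connected
  have hadj := (admissible (V := V)).adj_iff
  induction n using Nat.strong_induction_on with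
  | _ n ih =>
  intro p hp
  match n, ih, hp with
  | 0, _, _ => simp
  | 1, _, hp => exact SimpleGraph.dist_eq_one_iff_adj.2 ((hadj _ _).2 (Or.inl (hp 0 (by omega))))
  | k + 2, ih, hp =>
    have d0 := ih k (by omega) p (fun i hi => hp i (by omega))
    have d1 := ih (k + 1) (by omega) p (fun i hi => hp i (by omega))
    have a0 : arc (p k) (p (k + 1)) := hp k (by omega)
    have a1 : arc (p (k + 1)) (p (k + 2)) := hp (k + 1) (by omega)
    have A0 : (graph (V := V)).Adj (p k) (p (k + 1)) := (hadj _ _).2 (Or.inl a0)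
    have A1 : (graph (V := V)).Adj (p (k + 1)) (p (k + 2)) := (hadj _ _).2 (Or.inl a1)
    have e0 := SimpleGraph.dist_eq_one_iff_adj.2 A0
    have e1 := SimpleGraph.dist_eq_one_iff_adj.2 A1
    have b1 := dist_ne_of_adj A1 (p 0)
    have t1 := hc.dist_triangle (u := p 0) (v := p (k + 1)) (w := p (k + 2))
    have t2 := hc.dist_triangle (u := p 0) (v := p (k + 2)) (w := p (k + 1))
    have t3 := hc.dist_triangle (u := p k) (v := p (k + 1)) (w := p (k + 2))
    rw [SimpleGraph.dist_comm (u := p (k + 2)) (v := p (k + 1))] at t2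
    by_contra hne
    have d2 : (graph (V := V)).dist (p 0) (p (k + 2)) = k := by omega
    have hpp : p k ≠ p (k + 2) := by
      intro h
      rw [← h] at a1
      exact (admissible (V := V)).asymm _ _ a0 a1
    have f0 : (graph (V := V)).dist (p k) (p (k + 2)) ≠ 0 :=
      fun h => hpp (hc.dist_eq_zero_iff.1 h)
    have f1 : (graph (V := V)).dist (p k) (p (k + 2)) ≠ 1 := fun h =>
      dist_ne_of_adj (SimpleGraph.dist_eq_one_iff_adj.1 h) (p 0) (by omega)
    obtain ⟨m, m1, m2, m3⟩ := (modular (V := V)).exists_median (p k) (p (k + 2)) (p 0)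
    have c1 := SimpleGraph.dist_comm (G := graph (V := V)) (u := p 0) (v := p k)
    have c2 := SimpleGraph.dist_comm (G := graph (V := V)) (u := p 0) (v := p (k + 2))
    have c3 := SimpleGraph.dist_comm (G := graph (V := V)) (u := p 0) (v := m)
    have c4 := SimpleGraph.dist_comm (G := graph (V := V)) (u := p (k + 2)) (v := m)
    have B0 : (graph (V := V)).Adj (p k) m := SimpleGraph.dist_eq_one_iff_adj.1 (by omega)
    have B1 : (graph (V := V)).Adj (p (k + 2)) m := SimpleGraph.dist_eq_one_iff_adj.1 (by omega)
    have hm : p (k + 1) ≠ m := by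
      intro h
      rw [← h] at m3 c3
      omega
    have am : arc (p k) m :=
      ((admissible (V := V)).square _ _ _ _ A1 B1 B0.symm A0 hm hpp.symm).1 a1
    have := ih (k + 1) (by omega) (fun i => if i ≤ k then p i else m) (by
      intro i hi
      rcases Nat.lt_or_ge i k with h | h
      · simpa [h.le, Nat.succ_le_of_lt h] using hp i (by omega)
      · obtain rfl : i = k := by omega
        simpa using am)
    simp at this
    omega

/-- The order of an oriented modular graph: `x → y` is read as `y ≼ x`, and `≼` is the
reflexive-transitive closure. It is antisymmetric since an admissible orientation is acyclic. -/
instance : PartialOrder V where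
  le x y := Relation.ReflTransGen arc y x
  le_refl _ := Relation.ReflTransGen.refl
  le_trans _ _ _ h h' := h'.trans h
  le_antisymm := by
    have hc := (modular (V := V)).connected
    have key : ∀ x y : V, Relation.ReflTransGen arc x y → ∀ (n : ℕ) (p : ℕ → V),
        (∀ i < n, arc (p i) (p (i + 1))) → p n = x → ∃ (k : ℕ) (q : ℕ → V), n ≤ k ∧
          (∀ i < k, arc (q i) (q (i + 1))) ∧ q 0 = p 0 ∧ q k = y ∧ (k = n → x = y) := by
      intro x y h n p hp hx
      induction h with
      | refl => exact ⟨n, p, le_rfl, hp, rfl, hx, fun _ => rfl⟩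
      | @tail b c _ hbc ih =>
        obtain ⟨k, q, hk, hq, h0, hb, -⟩ := ih
        refine ⟨k + 1, fun i => if i ≤ k then q i else c, by omega, ?_, by simp [h0], by simp,
          fun h => by omega⟩
        intro i hi
        rcases Nat.lt_or_ge i k with h | h
        · simpa [h.le, Nat.succ_le_of_lt h] using hq i h
        · obtain rfl : i = k := by omega
          simpa [hb] using hbc
    intro x y hyx hxy
    obtain ⟨k, q, -, hq, h0, hk, hk'⟩ := key y x hyx 0 (fun _ => y) (by simp) rfl
    obtain ⟨l, r, hl, hr, h0', hl', -⟩ := key x y hxy k q hq hk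
    have := dist_of_directed l r hr
    rw [h0', h0, hl', SimpleGraph.dist_self] at this
    exact (hk' (by omega)).symm

end OrientedModularGraph

/-! ## Submodular functions on modular semilattices -/

section Submodular

variable {L : Type*} [PartialOrder L]

/-- The rank of `p`: the length of a maximal chain from the minimum element to `p`. -/
noncomputable def rank (p : L) : ℕ := (Order.height p).toNat

open Classical in
/-- The meet `p ∧ q`. (The value `p` is assigned when there is no meet; in the semilattices
below all meets exist.) -/
noncomputable def meet (p q : L) : L := if h : ∃ m, IsGLB {p, q} m then h.choose else p

/-- `I(p, q)`: all joins `a ∨ b` that exist, with `p ≽ a ≽ p ∧ q ≼ b ≼ q`. -/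
def joinSet (p q : L) : Set L :=
  {u | ∃ a ∈ Set.Icc (meet p q) p, ∃ b ∈ Set.Icc (meet p q) q, IsLUB {a, b} u}

/-- The vector `r(u; p, q) = (r(u ∧ p) - r(p ∧ q), r(u ∧ q) - r(p ∧ q))`. -/
noncomputable def rankVec (p q u : L) : ℝ × ℝ :=
  ((rank (meet u p) : ℝ) - rank (meet p q), (rank (meet u q) : ℝ) - rank (meet p q))

/-- `Conv I(p, q)`. -/
def convJoin (p q : L) : Set (ℝ × ℝ) := convexHull ℝ (rankVec p q '' joinSet p q)

/-- `E(p, q)`: the elements of `I(p, q)` mapped to maximal extreme points of `Conv I(p, q)`. -/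
def extremeJoins (p q : L) : Set L :=
  {u ∈ joinSet p q | rankVec p q u ∈ Set.extremePoints ℝ (convJoin p q) ∧
    Maximal (· ∈ convJoin p q) (rankVec p q u)}

/-- The nonnegative normal cone `C(u; p, q)` of `Conv I(p, q)` at `r(u; p, q)`. -/
def normalCone (p q u : L) : Set (ℝ × ℝ) :=
  {c | 0 ≤ c.1 ∧ 0 ≤ c.2 ∧ IsGreatest ((fun x : ℝ × ℝ => c.1 * x.1 + c.2 * x.2) '' convJoin p q)
    (c.1 * (rankVec p q u).1 + c.2 * (rankVec p q u).2)}

/-- `sin θ / (sin θ + cos θ)`. -/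
noncomputable def angleWeight (θ : ℝ) : ℝ := Real.sin θ / (Real.sin θ + Real.cos θ)

/-- The angles in `[0, π/2]` of the directions contained in `C`. -/
def coneAngles (C : Set (ℝ × ℝ)) : Set ℝ :=
  {θ | θ ∈ Set.Icc 0 (Real.pi / 2) ∧ (Real.cos θ, Real.sin θ) ∈ C}

/-- The value `[C]` of a closed convex cone `C` in the nonnegative quadrant: if `C` consists of the
directions with angles from `β` to `α`, then
`[C] = sin α / (sin α + cos α) - sin β / (sin β + cos β)`; see `coneWeight_eq`. -/
noncomputable def coneWeight (C : Set (ℝ × ℝ)) : ℝ :=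
  angleWeight (sSup (coneAngles C)) - angleWeight (sInf (coneAngles C))

theorem coneWeight_eq {α β : ℝ} (hβ : 0 ≤ β) (hαβ : β ≤ α) (hα : α ≤ Real.pi / 2) :
    coneWeight {c : ℝ × ℝ | 0 ≤ c.1 ∧ 0 ≤ c.2 ∧ c.2 * Real.cos α ≤ c.1 * Real.sin α ∧
        c.1 * Real.sin β ≤ c.2 * Real.cos β} =
      Real.sin α / (Real.sin α + Real.cos α) - Real.sin β / (Real.sin β + Real.cos β) := by
  have hpi := Real.pi_pos
  have key : ∀ s t : ℝ, s ∈ Set.Icc 0 (Real.pi / 2) → t ∈ Set.Icc 0 (Real.pi / 2) →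
      (Real.sin s * Real.cos t ≤ Real.cos s * Real.sin t ↔ s ≤ t) := by
    intro s t hs ht
    have h : Real.sin s * Real.cos t - Real.cos s * Real.sin t = Real.sin (s - t) :=
      (Real.sin_sub s t).symm
    rw [← sub_nonpos, h]
    constructor
    · intro h'
      by_contra hlt
      have := Real.sin_pos_of_pos_of_lt_pi (x := s - t) (by linarith) (by linarith [hs.2, ht.1])
      linarith
    · intro h'
      exact Real.sin_nonpos_of_nonpos_of_neg_pi_le (by linarith) (by linarith [hs.1, ht.2])
  have hA : coneAngles {c : ℝ × ℝ | 0 ≤ c.1 ∧ 0 ≤ c.2 ∧ c.2 * Real.cos α ≤ c.1 * Real.sin α ∧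
        c.1 * Real.sin β ≤ c.2 * Real.cos β} = Set.Icc β α := by
    ext θ
    simp only [coneAngles, Set.mem_ofPred_eq, Set.mem_Icc]
    constructor
    · rintro ⟨hθ, -, -, h1, h2⟩
      refine ⟨(key β θ ⟨hβ, by linarith⟩ hθ).1 (by linarith), (key θ α hθ ⟨by linarith, hα⟩).1 h1⟩
    · rintro ⟨h1, h2⟩
      have hθ : θ ∈ Set.Icc 0 (Real.pi / 2) := ⟨by linarith, by linarith⟩
      refine ⟨hθ, Real.cos_nonneg_of_mem_Icc ⟨by linarith, by linarith⟩,
        Real.sin_nonneg_of_nonneg_of_le_pi hθ.1 (by linarith [hθ.2]),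
        (key θ α hθ ⟨by linarith, hα⟩).2 h2, ?_⟩
      have := (key β θ ⟨hβ, by linarith⟩ hθ).2 h1
      linarith
  rw [coneWeight, hA, csSup_Icc hαβ, csInf_Icc hαβ]
  rfl

/-- `f : L → ℝ ∪ {∞}` is submodular:
`f p + f q ≥ f (p ∧ q) + ∑_{u ∈ E(p, q)} [C(u; p, q)] f u` for all `p`, `q`. -/
def IsSubmodular (f : L → WithTop ℝ) : Prop :=
  ∀ p q : L, f (meet p q) +
    ∑ᶠ u ∈ extremeJoins p q, (coneWeight (normalCone p q u) : WithTop ℝ) * f u ≤ f p + f q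

end Submodular

/-! ## L-convex functions and steepest descent -/

section Graph

variable {V : Type*}

/-- The effective domain of `g`. -/
def dom (g : V → WithTop ℝ) : Set V := {x | g x < ⊤}

/-- The set of minimizers of `g`. -/
def opt (g : V → WithTop ℝ) : Set V := {x | ∀ y : V, g x ≤ g y}

variable [OrientedModularGraph V]

variable (V) in
/-- Well-orientedness: every interval is complemented, that is, each of its elements is a join of
rank-1 elements of the interval. -/
def IsWellOriented : Prop :=
  ∀ p q : V, p ≤ q → ∀ u : Set.Icc p q, ∃ S : Set (Set.Icc p q), (∀ a ∈ S, rank a = 1) ∧ IsLUB S u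

/-- Any two members of `X` are joined by a sequence in `X` of successively comparable vertices. -/
def IsChainConnected (X : Set V) : Prop :=
  ∀ p ∈ X, ∀ q ∈ X, Relation.ReflTransGen (fun a b => a ∈ X ∧ b ∈ X ∧ (a ≤ b ∨ b ≤ a)) p q

/-- L-convexity: `g` is submodular on every principal filter, and on every principal ideal (a
semilattice under the reversed order), and its effective domain is chain-connected. -/
structure IsLConvex (g : V → WithTop ℝ) : Prop where
  submodular_filter : ∀ x : V, IsSubmodular (fun p : Set.Ici x => g p)
  submodular_ideal : ∀ x : V, IsSubmodular (fun p : (Set.Iic x)ᵒᵈ => g (OrderDual.ofDual p : Set.Iic x))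
  chainConnected : IsChainConnected (dom g)

variable (V) in
/-- The graph `Γ^Δ`: the edges of `Γ`, and all pairs of distinct vertices having both a meet and
a join in `Γ`. -/
def deltaGraph : SimpleGraph V where
  Adj p q := OrientedModularGraph.graph.Adj p q ∨
    p ≠ q ∧ (∃ m, IsGLB {p, q} m) ∧ ∃ j, IsLUB {p, q} j
  symm := ⟨by
    rintro p q (h | ⟨h, h1, h2⟩)
    · exact Or.inl h.symm
    · exact Or.inr ⟨h.symm, by simpa only [Set.pair_comm] using h1,
        by simpa only [Set.pair_comm] using h2⟩⟩
  loopless := ⟨by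
    rintro p (h | ⟨h, -⟩)
    · exact h.ne rfl
    · exact h rfl⟩

/-- `d_Δ(x, S) = min {d_Δ(x, y) | y ∈ S}` for nonempty `S`. -/
noncomputable def deltaDist (x : V) (S : Set V) : ℕ := sInf ((deltaGraph V).dist x '' S)

/-- `y` minimizes `g` over `I_x ∪ F_x`. -/
def IsSteepest (g : V → WithTop ℝ) (x y : V) : Prop :=
  y ∈ Set.Iic x ∪ Set.Ici x ∧ ∀ z ∈ Set.Iic x ∪ Set.Ici x, g y ≤ g z

/-- `s 0, s 1, …, s N` are the successive points visited by `N` iterations of steepest descent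
from `x`: each iteration finds a minimizer `y` of `g` over `I_x ∪ F_x` at the current point `x`
and, unless `g x = g y` (in which case the algorithm stops), moves to `y`. -/
def IsSDARun (g : V → WithTop ℝ) (x : V) (N : ℕ) (s : ℕ → V) : Prop :=
  s 0 = x ∧ ∀ i < N, IsSteepest g (s i) (s (i + 1)) ∧ g (s i) ≠ g (s (i + 1))

end Graph

end LConvex

/-! A zigzag ball of radius `k` around `x` consists of the vertices reached from `x` by `k`
alternately ascending and descending comparisons, the direction of the last one being prescribed.
After `i + 1` iterations the current point minimizes `g` over one of the two balls of radius `i + 1`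
(`IsFracConvex.run_min`). A vertex at distance `d` from `x` in the graph `Γ^Δ` lies in both balls of
radius `d + 1` (`mem_zigBall_of_walk`). So after `d + 1` iterations the value at the current point
is the global minimum, and no further iteration can lower it.

The inductive step is `IsFracConvex.descend`. If `s` minimizes `g` over a ball closed upwards, a
strictly improving step must go down, to some `s'`. Zigzag balls are geodesically convex, and
restricting `g` to one of them keeps the needed inequalities. A comparison of `s` with the elements
above `s'` shows that `s'` is a local minimizer of `g` restricted to the next ball. Local minimizers
are global (`IsFracConvex.le_of_local`).

For local-to-global, each `w` in a ball of radius `k + 1` has a gate, the extremal element of the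
opposite ball of radius `k` comparable with it. The gate lies in `dom g` when `x` and `w` do
(`IsFracConvex.gate_mem_aux`). If `x` is a local minimizer, passing to the gate does not increase
`g` (`IsFracConvex.gateMono`). Iterating leads back to `x`.

Submodularity is used only through `HasFracJoin`: the numbers `[C(u; p, q)]` are lengths of
intervals that cover `[0, 1]` up to finitely many overlaps and gaps, hence are the weights of a
convex combination. -/

namespace LConvex

/-! ## Metric and order structure of oriented modular graphs -/

section Metric

open OrientedModularGraph

variable {V : Type*} [OrientedModularGraph V]

/-- The shortest path metric of the underlying graph. -/
noncomputable def dst (x y : V) : ℕ := (graph (V := V)).dist x y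

/-- `z` lies on a shortest path from `x` to `y`. -/
def Btw (x z y : V) : Prop := dst x z + dst z y = dst x y

/-- Geodesically convex sets of vertices. -/
def IsConv (C : Set V) : Prop := ∀ p ∈ C, ∀ q ∈ C, ∀ z, Btw p z q → z ∈ C

theorem dst_comm (x y : V) : dst x y = dst y x := SimpleGraph.dist_comm

@[simp] theorem dst_self (x : V) : dst x x = 0 := SimpleGraph.dist_self

theorem dst_triangle (x y z : V) : dst x z ≤ dst x y + dst y z :=
  (modular (V := V)).connected.dist_triangle

theorem dst_eq_zero {x y : V} : dst x y = 0 ↔ x = y :=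
  (modular (V := V)).connected.dist_eq_zero_iff

theorem dst_eq_one {x y : V} : dst x y = 1 ↔ arc x y ∨ arc y x :=
  SimpleGraph.dist_eq_one_iff_adj.trans ((admissible (V := V)).adj_iff x y)

theorem dst_ne {x y : V} (h : dst x y = 1) (z : V) : dst z x ≠ dst z y :=
  dist_ne_of_adj (SimpleGraph.dist_eq_one_iff_adj.1 h) z

theorem Btw.symm {x z y : V} (h : Btw x z y) : Btw y z x := by
  unfold Btw at *
  rw [dst_comm y z, dst_comm z x, dst_comm y x]; omega

theorem Btw.right (x y : V) : Btw x y y := by simp [Btw]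

theorem Btw.trans_left {x z y w : V} (h : Btw x z y) (h' : Btw x w z) : Btw x w y := by
  unfold Btw at *
  have := dst_triangle w z y
  have := dst_triangle x w y
  omega

theorem exists_median (x y z : V) : ∃ m, Btw x m y ∧ Btw y m z ∧ Btw x m z := by
  obtain ⟨m, h1, h2, h3⟩ := (modular (V := V)).exists_median x y z
  exact ⟨m, h1.symm, h2.symm, h3.symm⟩

theorem square_arc {a b c d : V} (h1 : dst a b = 1) (h2 : dst b c = 1) (h3 : dst c d = 1)
    (h4 : dst d a = 1) (hac : a ≠ c) (hbd : b ≠ d) : arc a b ↔ arc d c :=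
  (admissible (V := V)).square a b c d (SimpleGraph.dist_eq_one_iff_adj.1 h1)
    (SimpleGraph.dist_eq_one_iff_adj.1 h2) (SimpleGraph.dist_eq_one_iff_adj.1 h3)
    (SimpleGraph.dist_eq_one_iff_adj.1 h4) hac hbd

theorem exists_pred {x y : V} {k : ℕ} (h : dst x y = k + 1) : ∃ z, dst x z = k ∧ dst z y = 1 := by
  obtain ⟨w, hw⟩ := (modular (V := V)).connected.exists_walk_length_eq_dist y x
  cases w with
  | nil => simp at h
  | @cons _ z _ hadj w =>
    have h1 : dst y z = 1 := SimpleGraph.dist_eq_one_iff_adj.2 hadj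
    have h2 : dst z x ≤ w.length := SimpleGraph.dist_le w
    have h3 : w.length + 1 = dst y x := by simpa [dst] using hw
    have h4 := dst_triangle y z x
    rw [dst_comm x y] at h
    exact ⟨z, by rw [dst_comm]; omega, by rw [dst_comm]; exact h1⟩

theorem le_of_arc {x y : V} (h : arc y x) : x ≤ y := Relation.ReflTransGen.single h

theorem exists_directed {x y : V} (h : x ≤ y) :
    ∃ (n : ℕ) (p : ℕ → V), p 0 = y ∧ p n = x ∧ ∀ i < n, arc (p i) (p (i + 1)) := by
  have h' : Relation.ReflTransGen arc y x := h
  induction h' using Relation.ReflTransGen.head_induction_on with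
  | refl => exact ⟨0, fun _ => x, rfl, rfl, by simp⟩
  | @head a b hab hb ih =>
    obtain ⟨n, p, h0, hn, hp⟩ := ih hb
    refine ⟨n + 1, fun i => Nat.casesOn i a p, rfl, hn, ?_⟩
    rintro (_ | i) hi
    · simpa [h0] using hab
    · exact hp i (by omega)

/-- Prepending the arc to a directed path from `r` to `x` gives a directed path, and directed paths
are geodesics. -/
theorem dst_arc_le {x r q : V} (h : x ≤ r) (hq : arc q r) : dst x q = dst x r + 1 := by
  obtain ⟨n, p, h0, hn, hp⟩ := exists_directed h
  have h1 := dist_of_directed n p hp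
  have h2 := dist_of_directed (n + 1) (fun i => Nat.casesOn (motive := fun _ => V) i q p) (by
    rintro (_ | i) hi
    · simpa [h0] using hq
    · exact hp i (by omega))
  rw [h0, hn] at h1
  change (graph (V := V)).dist q (p n) = n + 1 at h2
  rw [hn] at h2
  rw [dst_comm x q, dst_comm x r]
  exact h2.trans (by rw [← h1]; rfl)

/-- Let `r` follow `q` on a directed path to `x`. The median `y` of `v`, `r`, `x` closes a 4-cycle
`q, v, y, r`; by induction `r → y`, and admissibility carries the directions of `q → r` and `r → y`
over to the opposite edges. -/
theorem arc_of_dst_lt {x q v : V} (h : x ≤ q) (hv : dst v q = 1) (hd : dst x v + 1 = dst x q) :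
    x ≤ v ∧ arc q v := by
  induction hk : dst x q using Nat.strong_induction_on generalizing q v with
  | _ k ih =>
  rcases Relation.ReflTransGen.cases_head (show Relation.ReflTransGen arc q x from h) with
    rfl | ⟨r, hr, hrx⟩
  · simp at hd
  have hxr : x ≤ r := hrx
  have e := dst_arc_le hxr hr
  by_cases hvr : v = r
  · subst hvr; exact ⟨hxr, hr⟩
  obtain ⟨y, y1, y2, y3⟩ := exists_median v r x
  have qr : dst q r = 1 := dst_eq_one.2 (Or.inl hr)
  have t := dst_triangle v q r
  have n0 : dst v r ≠ 0 := fun h => hvr (dst_eq_zero.1 h)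
  have n1 : dst v r ≠ 1 := fun h => dst_ne h x (by omega)
  unfold Btw at y1 y2 y3
  have c1 := dst_comm x v
  have c2 := dst_comm x r
  have c3 := dst_comm x y
  have c4 := dst_comm y r
  have hy : dst y r = 1 := by omega
  obtain ⟨hxy, hry⟩ := ih (dst x r) (by omega) hxr hy (by omega) rfl
  have hqy : q ≠ y := by rintro rfl; omega
  have hvy : dst v y = 1 := by omega
  have := (square_arc qr (by omega) (by rw [dst_comm]; exact hvy) hv hqy (Ne.symm hvr))
  have hvy' : arc v y := (this).1 hr
  refine ⟨hxy.trans (le_of_arc hvy'), ?_⟩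
  have h5 := square_arc (a := q) (b := v) (c := y) (d := r) (by rw [dst_comm]; exact hv) hvy hy
    (by rw [dst_comm]; exact qr) hqy hvr
  exact h5.2 hry

/-- With `btw_of_le`, this identifies order intervals with metric intervals, so that order questions
become distance computations. -/
theorem le_of_btw {x z q : V} (h : x ≤ q) (hz : Btw x z q) : x ≤ z ∧ z ≤ q := by
  induction hk : dst z q generalizing q with
  | zero => rw [dst_eq_zero.1 hk]; exact ⟨h, le_rfl⟩
  | succ k ih =>
    obtain ⟨q', h1, h2⟩ := exists_pred hk
    have t1 := dst_triangle x z q'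
    have t2 := dst_triangle x q' q
    unfold Btw at hz
    obtain ⟨h3, h4⟩ := arc_of_dst_lt h h2 (by omega)
    obtain ⟨h5, h6⟩ := ih h3 (by unfold Btw; omega) h1
    exact ⟨h5, h6.trans (le_of_arc h4)⟩

theorem btw_of_le {x z q : V} (h : x ≤ z) (h' : z ≤ q) : Btw x z q := by
  have h'' : Relation.ReflTransGen arc q z := h'
  induction h'' using Relation.ReflTransGen.head_induction_on with
  | refl => exact Btw.right x z
  | @head a b hab hb ih =>
    have := ih hb
    have e1 := dst_arc_le (h.trans hb) hab
    have e2 := dst_arc_le hb hab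
    unfold Btw at *; omega

/-! ### Convexity -/

/-- In a modular graph, connected sets that are closed under common neighbours are convex. -/
theorem isConv_of_local {S : Set V}
    (hc : ∀ p ∈ S, ∀ q ∈ S, Relation.ReflTransGen (fun a b => b ∈ S ∧ dst a b = 1) p q)
    (h2 : ∀ p ∈ S, ∀ q ∈ S, dst p q = 2 → ∀ v, dst p v = 1 → dst v q = 1 → v ∈ S) : IsConv S := by
  have key : ∀ p ∈ S, ∀ k, ∀ r q, r ∈ S → q ∈ S → dst r q = 1 → dst p r = k → dst p q = k + 1 →
      (∀ z, Btw p z r → z ∈ S) → ∀ z, Btw p z q → z ∈ S := by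
    intro p hp k
    induction k with
    | zero =>
      intro r q hr hq h1 h2 h3 _ z hz
      unfold Btw at hz
      rcases Nat.eq_zero_or_pos (dst z q) with h | h
      · rwa [dst_eq_zero.1 h]
      · rwa [← dst_eq_zero.1 (show dst p z = 0 by omega)]
    | succ k ih =>
      intro r q hr hq h1 hpr hpq hI z hz
      rcases Nat.eq_zero_or_pos (dst z q) with h | h
      · rwa [dst_eq_zero.1 h]
      obtain ⟨q', hq1, hq2⟩ := exists_pred (show dst z q = (dst z q - 1) + 1 by omega)
      have t1 := dst_triangle p z q'
      have t2 := dst_triangle p q' q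
      have hz' := hz
      unfold Btw at hz
      have hpq' : dst p q' = k + 1 := by omega
      have hzq' : Btw p z q' := by unfold Btw; omega
      by_cases hrq : q' = r
      · subst hrq; exact hI z hzq'
      -- The median is a common neighbour of `q'` and `r` one step closer to `p`. It lies in `S`
      -- since it is between `p` and `r`, so `q'`, a common neighbour of `y` and `q`, lies in `S`
      -- too, and the induction continues with the edge `y q'`.
      obtain ⟨y, y1, y2, y3⟩ := exists_median q' r p
      have t := dst_triangle q' q r
      have n0 : dst q' r ≠ 0 := fun h => hrq (dst_eq_zero.1 h)
      have n1 : dst q' r ≠ 1 := fun h => dst_ne h p (by omega)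
      have c0 := dst_comm q r
      have c1 := dst_comm p q'
      have c2 := dst_comm p r
      have c3 := dst_comm p y
      have c4 := dst_comm y r
      have c5 := dst_comm q' y
      have yr : Btw p y r := y2.symm
      unfold Btw at y1 y2 y3
      have hyS : y ∈ S := hI y yr
      have hyq : dst y q = 2 := by
        have := dst_triangle y q' q
        have := dst_triangle p y q
        omega
      have hq'S : q' ∈ S := h2 y hyS q hq hyq q' (by omega) (by omega)
      exact ih y q' hyS hq'S (by omega) (by omega) hpq' (fun z hz => hI z (yr.trans_left hz)) z hzq'
  intro p hp q hq
  have hpq := hc p hp q hq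
  clear hq
  have : q ∈ S ∧ ∀ z, Btw p z q → z ∈ S := by
    induction hpq with
    | refl =>
      refine ⟨hp, fun z hz => ?_⟩
      unfold Btw at hz
      rwa [← dst_eq_zero.1 (show dst p z = 0 by simp at hz; omega)]
    | @tail r q _ hrq ih =>
      refine ⟨hrq.1, ?_⟩
      have t1 := dst_triangle p r q
      have t2 := dst_triangle p q r
      have c := dst_comm q r
      have n := dst_ne hrq.2 p
      have := hrq.2
      rcases Nat.lt_or_ge (dst p r) (dst p q) with h | h
      · exact key p hp (dst p r) r q ih.1 hrq.1 hrq.2 rfl (by omega) ih.2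
      · intro z hz
        exact ih.2 z (Btw.trans_left (z := q) (by unfold Btw; omega) hz)
  exact this.2

theorem reach_of_le {S : Set V} {x y : V} (h : x ≤ y) (hS : ∀ z, x ≤ z → z ≤ y → z ∈ S) :
    Relation.ReflTransGen (fun a b => b ∈ S ∧ dst a b = 1) x y := by
  have h' : Relation.ReflTransGen arc y x := h
  induction h' using Relation.ReflTransGen.head_induction_on with
  | refl => exact Relation.ReflTransGen.refl
  | @head a b hab hb ih =>
    exact (ih hb fun z h1 h2 => hS z h1 (h2.trans (le_of_arc hab))).tail
      ⟨hS a h le_rfl, dst_eq_one.2 (Or.inr hab)⟩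

theorem reach_of_ge {S : Set V} {x y : V} (h : x ≤ y) (hS : ∀ z, x ≤ z → z ≤ y → z ∈ S) :
    Relation.ReflTransGen (fun a b => b ∈ S ∧ dst a b = 1) y x := by
  have h' : Relation.ReflTransGen arc y x := h
  induction h' using Relation.ReflTransGen.head_induction_on with
  | refl => exact Relation.ReflTransGen.refl
  | @head a b hab hb ih =>
    exact (ih hb fun z h1 h2 => hS z h1 (h2.trans (le_of_arc hab))).head
      ⟨hS b hb (le_of_arc hab), dst_eq_one.2 (Or.inl hab)⟩

theorem reach_of_isConv {S : Set V} (hS : IsConv S) {x y : V} (hx : x ∈ S) (hy : y ∈ S) :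
    Relation.ReflTransGen (fun a b => b ∈ S ∧ dst a b = 1) x y := by
  induction hk : dst x y generalizing y with
  | zero => rw [dst_eq_zero.1 hk]
  | succ k ih =>
    obtain ⟨z, h1, h2⟩ := exists_pred hk
    exact (ih (hS x hx y hy z (by unfold Btw; omega)) h1).tail ⟨hy, h2⟩

/-- By the local criterion only a common neighbour `v` below both `p` and `q` matters. If it were
farther from `x` than both, the median of `p`, `q`, `x` would close a 4-cycle with inconsistent
orientation; otherwise `arc_of_dst_lt` applies. -/
theorem isConv_Ici (x : V) : IsConv (Set.Ici x) := by
  apply isConv_of_local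
  · intro p hp q hq
    exact (reach_of_ge hp fun z hz _ => hz).trans (reach_of_le hq fun z hz _ => hz)
  · intro p hp q hq hpq v hpv hvq
    rw [Set.mem_Ici] at *
    rcases dst_eq_one.1 hpv with hpv' | hpv'
    swap
    · exact hp.trans (le_of_arc hpv')
    rcases dst_eq_one.1 hvq with hvq' | hvq'
    · exact hq.trans (le_of_arc hvq')
    by_cases h1 : dst x v + 1 = dst x q
    · exact (arc_of_dst_lt hq hvq h1).1
    by_cases h2 : dst x v + 1 = dst x p
    · exact (arc_of_dst_lt hp (by rw [dst_comm]; exact hpv) h2).1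
    exfalso
    have n1 := dst_ne hpv x
    have n2 := dst_ne hvq x
    have t1 := dst_triangle x p v
    have t2 := dst_triangle x v p
    have t3 := dst_triangle x v q
    have t4 := dst_triangle x q v
    have c1 := dst_comm v p
    have c2 := dst_comm v q
    obtain ⟨m, m1, m2, m3⟩ := exists_median p q x
    have c3 := dst_comm p x
    have c4 := dst_comm q x
    have c5 := dst_comm m x
    have c6 := dst_comm m q
    have c7 := dst_comm m p
    unfold Btw at m1 m2 m3
    obtain ⟨-, h3⟩ := arc_of_dst_lt hq (v := m) (by omega) (by omega)
    have h4 := square_arc (a := p) (b := v) (c := q) (d := m) hpv hvq (by omega) (by omega)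
      (by rintro rfl; simp at hpq) (by rintro rfl; omega)
    exact (admissible (V := V)).asymm _ _ h3 (h4.1 hpv')

theorem IsConv.inter {C D : Set V} (hC : IsConv C) (hD : IsConv D) : IsConv (C ∩ D) :=
  fun p hp q hq z hz => ⟨hC p hp.1 q hq.1 z hz, hD p hp.2 q hq.2 z hz⟩

theorem isConv_singleton (x : V) : IsConv ({x} : Set V) := by
  intro p hp q hq z hz
  rw [Set.mem_singleton_iff] at hp hq
  rw [hp, hq, Btw, dst_self] at hz
  exact (dst_eq_zero.1 (show dst x z = 0 by omega)).symm

/-- Convex sets have the Helly property for triples. -/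
theorem IsConv.helly {A B C : Set V} (hA : IsConv A) (hB : IsConv B) (hC : IsConv C)
    (hAB : (A ∩ B).Nonempty) (hBC : (B ∩ C).Nonempty) (hAC : (A ∩ C).Nonempty) :
    (A ∩ B ∩ C).Nonempty := by
  obtain ⟨x, hx⟩ := hAB
  obtain ⟨y, hy⟩ := hBC
  obtain ⟨z, hz⟩ := hAC
  obtain ⟨m, h1, h2, h3⟩ := exists_median x y z
  exact ⟨m, ⟨hA x hx.1 z hz.1 m h3, hB x hx.2 y hy.1 m h1⟩, hC y hy.2 z hz.2 m h2⟩

/-- The least element is the member nearest to `w`: its median with `w` and any other member is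
again a member, hence equals it, and betweenness turns into order. -/
theorem IsConv.exists_isLeast {C : Set V} (hC : IsConv C) {w : V} (h : (C ∩ Set.Ici w).Nonempty) :
    ∃ t, IsLeast (C ∩ Set.Ici w) t := by
  obtain ⟨t, ht, hmin⟩ : ∃ t ∈ C ∩ Set.Ici w, ∀ c ∈ C ∩ Set.Ici w, dst w t ≤ dst w c := by
    exact ⟨Function.argminOn (dst w) _ h, Function.argminOn_mem _ _ h,
      fun c hc => Function.argminOn_le (dst w) _ hc⟩
  refine ⟨t, ht, fun c hc => ?_⟩
  obtain ⟨m, h1, h2, h3⟩ := exists_median w t c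
  have hm := hC.inter (isConv_Ici w) t ht c hc m h2
  have := hmin m hm
  unfold Btw at h1
  have hmt : m = t := dst_eq_zero.1 (by omega)
  subst hmt
  exact (le_of_btw hc.2 h3).2

/-- The least element of `C` above `w` is the gate of `w` in `C`. -/
theorem IsConv.dst_gate {C : Set V} (hC : IsConv C) {w t : V} (ht : IsLeast (C ∩ Set.Ici w) t)
    {c : V} (hc : c ∈ C) : Btw w t c := by
  obtain ⟨m, h1, h2, h3⟩ := exists_median w t c
  have hm := hC t ht.1.1 c hc m h2
  have hw := le_of_btw ht.1.2 h1
  rwa [← le_antisymm hw.2 (ht.2 ⟨hm, hw.1⟩)]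

/-! ### Duality -/

variable (V) in
/-- The oriented modular graph with all arcs reversed. -/
abbrev opp : OrientedModularGraph V where
  graph := graph
  arc x y := arc y x
  modular := modular
  admissible :=
    { adj_iff := fun x y => ((admissible (V := V)).adj_iff x y).trans or_comm
      asymm := fun x y h => (admissible (V := V)).asymm y x h
      square := fun a b c d h1 h2 h3 h4 h5 h6 =>
        (admissible (V := V)).square b a d c h1.symm h4.symm h3.symm h2.symm h6 h5 }

variable (V) in
/-- The reversed order, as the order of the reversed graph. -/
abbrev oppOrder : PartialOrder V := @instPartialOrder V (opp V)

/-- The order generated by the reversed arcs is equivalent to the reversed order but not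
definitionally equal to it. This and the following translations let every result be applied to `opp
V` to obtain its dual. -/
theorem opp_le {x y : V} : (oppOrder V).le x y ↔ y ≤ x :=
  Relation.reflTransGen_swap (r := arc)

theorem opp_isLUB {S : Set V} {j : V} : @IsLUB V (oppOrder V).toLE S j ↔ IsGLB S j := by
  have h (x : V) : x ∈ @upperBounds V (oppOrder V).toLE S ↔ x ∈ lowerBounds S :=
    forall_congr' fun _ => imp_congr Iff.rfl opp_le
  exact and_congr (h j) (forall_congr' fun x => imp_congr (h x) opp_le)

theorem opp_isGLB {S : Set V} {j : V} : @IsGLB V (oppOrder V).toLE S j ↔ IsLUB S j := by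
  have h (x : V) : x ∈ @lowerBounds V (oppOrder V).toLE S ↔ x ∈ upperBounds S :=
    forall_congr' fun _ => imp_congr Iff.rfl opp_le
  exact and_congr (h j) (forall_congr' fun x => imp_congr (h x) opp_le)

theorem opp_Ici (x : V) : @Set.Ici V (oppOrder V).toPreorder x = Set.Iic x :=
  Set.ext fun _ => opp_le

theorem opp_Iic (x : V) : @Set.Iic V (oppOrder V).toPreorder x = Set.Ici x :=
  Set.ext fun _ => opp_le

theorem opp_isLeast {S : Set V} {t : V} : @IsLeast V (oppOrder V).toLE S t ↔ IsGreatest S t :=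
  and_congr Iff.rfl (forall_congr' fun _ => imp_congr Iff.rfl opp_le)

theorem opp_isGreatest {S : Set V} {t : V} : @IsGreatest V (oppOrder V).toLE S t ↔ IsLeast S t :=
  and_congr Iff.rfl (forall_congr' fun _ => imp_congr Iff.rfl opp_le)

end Metric

/-! ### Meets, joins and rank identities. -/

section Lattice

open OrientedModularGraph

variable {V : Type*} [OrientedModularGraph V]

theorem isLUB_pair_iff {α : Type*} [PartialOrder α] {a b j : α} :
    IsLUB {a, b} j ↔ a ≤ j ∧ b ≤ j ∧ ∀ c, a ≤ c → b ≤ c → j ≤ c := by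
  simp [IsLUB, IsLeast, mem_lowerBounds, and_assoc]

theorem isGLB_pair_iff {α : Type*} [PartialOrder α] {a b j : α} :
    IsGLB {a, b} j ↔ j ≤ a ∧ j ≤ b ∧ ∀ c, c ≤ a → c ≤ b → c ≤ j := by
  simp [IsGLB, IsGreatest, mem_upperBounds, and_assoc]

theorem isGLB_pair_comm {α : Type*} [PartialOrder α] {a b j : α} (h : IsGLB {a, b} j) :
    IsGLB {b, a} j := by rwa [Set.pair_comm]

theorem isLUB_pair_comm {α : Type*} [PartialOrder α] {a b j : α} (h : IsLUB {a, b} j) :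
    IsLUB {b, a} j := by rwa [Set.pair_comm]

theorem IsConv.exists_isGreatest {C : Set V} (hC : IsConv C) {w : V}
    (h : (C ∩ Set.Iic w).Nonempty) : ∃ t, IsGreatest (C ∩ Set.Iic w) t := by
  rw [← opp_Ici] at h
  obtain ⟨t, ht⟩ := @IsConv.exists_isLeast V (opp V) C hC w h
  exact ⟨t, by rw [← opp_Ici]; exact opp_isLeast.1 ht⟩

theorem IsConv.dst_gate' {C : Set V} (hC : IsConv C) {w t : V}
    (ht : IsGreatest (C ∩ Set.Iic w) t) {c : V} (hc : c ∈ C) : Btw w t c := by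
  rw [← opp_Ici] at ht
  exact @IsConv.dst_gate V (opp V) C hC w t (opp_isLeast.2 ht) c hc

theorem exists_isLUB {p q c : V} (hp : p ≤ c) (hq : q ≤ c) : ∃ j, IsLUB {p, q} j := by
  obtain ⟨j, hj, hj'⟩ := (isConv_Ici p).exists_isLeast (w := q) ⟨c, hp, hq⟩
  exact ⟨j, isLUB_pair_iff.2 ⟨hj.1, hj.2, fun d h1 h2 => hj' ⟨h1, h2⟩⟩⟩

theorem exists_isGLB {p q c : V} (hp : c ≤ p) (hq : c ≤ q) : ∃ j, IsGLB {p, q} j := by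
  obtain ⟨j, hj⟩ := @exists_isLUB V (opp V) p q c (opp_le.2 hp) (opp_le.2 hq)
  exact ⟨j, opp_isLUB.1 hj⟩

/-- The median of `m`, `p`, `q` is above `m` and below both `p` and `q`, so it is `m`. -/
theorem btw_of_isGLB {p q m : V} (h : IsGLB {p, q} m) : Btw p m q := by
  obtain ⟨h1, h2, h3⟩ := isGLB_pair_iff.1 h
  obtain ⟨n, n1, n2, n3⟩ := exists_median m p q
  have e1 := le_of_btw h1 n1
  have e2 := le_of_btw h2 n3
  rwa [← le_antisymm e1.1 (h3 n e1.2 e2.2)] at n2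

theorem btw_of_isLUB {p q m : V} (h : IsLUB {p, q} m) : Btw p m q :=
  @btw_of_isGLB V (opp V) p q m (opp_isGLB.2 h)

/-- Pairwise bounded triples are bounded. -/
theorem exists_upper_bound {a b c x y z : V} (h1 : a ≤ x) (h2 : b ≤ x) (h3 : b ≤ y) (h4 : c ≤ y)
    (h5 : a ≤ z) (h6 : c ≤ z) : ∃ d, a ≤ d ∧ b ≤ d ∧ c ≤ d := by
  obtain ⟨d, ⟨hd1, hd2⟩, hd3⟩ := (isConv_Ici a).helly (isConv_Ici b) (isConv_Ici c)
    ⟨x, h1, h2⟩ ⟨y, h3, h4⟩ ⟨z, h5, h6⟩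
  exact ⟨d, hd1, hd2, hd3⟩

/-- The isomorphism of transposed intervals, at the level of ranks. -/
theorem dst_transpose {a b m j : V} (hm : IsGLB {a, b} m) (hj : IsLUB {a, b} j) :
    dst m a = dst b j ∧ dst m b = dst a j := by
  have h1 := btw_of_isGLB hm
  have h2 := btw_of_isLUB hj
  obtain ⟨m1, m2, -⟩ := isGLB_pair_iff.1 hm
  obtain ⟨j1, j2, -⟩ := isLUB_pair_iff.1 hj
  have h3 := btw_of_le m1 j1
  have h4 := btw_of_le m2 j2
  have c1 := dst_comm m a
  have c2 := dst_comm b j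
  unfold Btw at *
  omega

theorem eq_of_le_of_dst {m a c : V} (h1 : m ≤ a) (h2 : a ≤ c) (h : dst m c ≤ dst m a) : a = c := by
  have := btw_of_le h1 h2
  unfold Btw at this
  exact dst_eq_zero.1 (by omega)

theorem dst_mono {m a c : V} (h1 : m ≤ a) (h2 : a ≤ c) : dst m a ≤ dst m c := by
  have := btw_of_le h1 h2
  unfold Btw at this
  omega

/-! ### Joins of elements below `p` with elements below `q`. -/

section Joins

variable {p q m a b u : V}

theorem isGLB_of_le (hm : IsGLB {p, q} m) (ha : m ≤ a) (ha' : a ≤ p) (hb : m ≤ b) (hb' : b ≤ q) :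
    IsGLB {a, b} m :=
  isGLB_pair_iff.2 ⟨ha, hb, fun c h1 h2 =>
    (isGLB_pair_iff.1 hm).2.2 c (h1.trans ha') (h2.trans hb')⟩

/-- The path `p, a, u, b, q` has the same length as `p, m, q`, because transposed intervals have
equal rank. -/
theorem btw_of_join (hm : IsGLB {p, q} m) (ha : m ≤ a) (ha' : a ≤ p) (hb : m ≤ b) (hb' : b ≤ q)
    (hu : IsLUB {a, b} u) : Btw p u q := by
  have h1 := dst_transpose (isGLB_of_le hm ha ha' hb hb') hu
  have h2 := btw_of_isGLB hm
  have h3 := btw_of_le ha ha'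
  have h4 := btw_of_le hb hb'
  have t1 := dst_triangle p a u
  have t2 := dst_triangle u b q
  have t3 := dst_triangle p u q
  have c1 := dst_comm p a
  have c2 := dst_comm u b
  have c3 := dst_comm p m
  unfold Btw at *
  omega

/-- If `c` is the meet of `u` and `p`, then `a ≤ c` and `c ∨ b` is still `u`; transposition gives
`a` and `c` the same rank, hence `a = c`. So `u` determines `a` and `b`. -/
theorem isGLB_join_left (hm : IsGLB {p, q} m) (ha : m ≤ a) (ha' : a ≤ p) (hb : m ≤ b)
    (hb' : b ≤ q) (hu : IsLUB {a, b} u) : IsGLB {u, p} a := by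
  obtain ⟨h1, h2, h3⟩ := isLUB_pair_iff.1 hu
  obtain ⟨c, hc⟩ := exists_isGLB h1 ha'
  obtain ⟨c1, c2, c3⟩ := isGLB_pair_iff.1 hc
  have hac := c3 a h1 ha'
  have e1 := dst_transpose (isGLB_of_le hm ha ha' hb hb') hu
  have e2 := dst_transpose (isGLB_of_le hm (ha.trans hac) c2 hb hb')
    (isLUB_pair_iff.2 ⟨c1, h2, fun d d1 d2 => h3 d (hac.trans d1) d2⟩)
  rwa [eq_of_le_of_dst ha hac (by omega)]

theorem isGLB_join_right (hm : IsGLB {p, q} m) (ha : m ≤ a) (ha' : a ≤ p) (hb : m ≤ b)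
    (hb' : b ≤ q) (hu : IsLUB {a, b} u) : IsGLB {u, q} b :=
  isGLB_join_left (isGLB_pair_comm hm) hb hb' ha ha' (isLUB_pair_comm hu)

end Joins

/-! ### Up- and down-closures of convex sets -/

/-- The vertices above some member of `C`. -/
def upClosure (C : Set V) : Set V := {w | ∃ t ∈ C, t ≤ w}

/-- The vertices below some member of `C`. -/
def downClosure (C : Set V) : Set V := {w | ∃ t ∈ C, w ≤ t}

theorem isUpperSet_upClosure (C : Set V) : IsUpperSet (upClosure C) :=
  fun _ _ hab ⟨t, ht, h⟩ => ⟨t, ht, h.trans hab⟩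

theorem isLowerSet_downClosure (C : Set V) : IsLowerSet (downClosure C) :=
  fun _ _ hab ⟨t, ht, h⟩ => ⟨t, ht, hab.trans h⟩

theorem subset_downClosure (C : Set V) : C ⊆ downClosure C := fun c hc => ⟨c, hc, le_rfl⟩

theorem opp_upClosure (C : Set V) : @upClosure V (opp V) C = downClosure C :=
  Set.ext fun _ => exists_congr fun _ => and_congr Iff.rfl opp_le

theorem opp_downClosure (C : Set V) : @downClosure V (opp V) C = upClosure C :=
  Set.ext fun _ => exists_congr fun _ => and_congr Iff.rfl opp_le

/-- By the local criterion the only nontrivial case is a common neighbour `v` above `p` and `q`,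
which is then their join. The Helly property gives one member of `C` above both `p` and `q`, hence
above `v`. -/
theorem isConv_downClosure {C : Set V} (hC : IsConv C) :
    IsConv (downClosure C) := by
  apply isConv_of_local
  · rintro p ⟨p', hp', hpp'⟩ q ⟨q', hq', hqq'⟩
    have h1 := reach_of_le (S := downClosure C) hpp' fun z _ hz => ⟨p', hp', hz⟩
    have h2 := reach_of_ge (S := downClosure C) hqq' fun z _ hz => ⟨q', hq', hz⟩
    have h3 : Relation.ReflTransGen (fun a b => b ∈ downClosure C ∧ dst a b = 1) p' q' :=
      Relation.ReflTransGen.mono (fun a b h => ⟨subset_downClosure C h.1, h.2⟩) _ _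
        (reach_of_isConv hC hp' hq')
    exact h1.trans (h3.trans h2)
  · rintro p ⟨p', hp', hpp'⟩ q ⟨q', hq', hqq'⟩ hpq v hpv hvq
    rcases dst_eq_one.1 hpv with h | h
    · exact ⟨p', hp', (le_of_arc h).trans hpp'⟩
    rcases dst_eq_one.1 hvq with h' | h'
    swap
    · exact ⟨q', hq', (le_of_arc h').trans hqq'⟩
    obtain ⟨c, ⟨hc1, hc2⟩, hc3⟩ := hC.helly (isConv_Ici p) (isConv_Ici q)
      ⟨p', hp', hpp'⟩ ⟨v, le_of_arc h, le_of_arc h'⟩ ⟨q', hq', hqq'⟩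
    obtain ⟨j, hj⟩ := exists_isLUB (le_of_arc h) (le_of_arc h')
    obtain ⟨j1, j2, j3⟩ := isLUB_pair_iff.1 hj
    have hjv := j3 v (le_of_arc h) (le_of_arc h')
    have b1 := btw_of_isLUB hj
    have b2 := btw_of_le j1 hjv
    have b3 := btw_of_le j2 hjv
    have c1 := dst_comm q j
    have c2 := dst_comm q v
    unfold Btw at b1 b2 b3
    have : j = v := dst_eq_zero.1 (by omega)
    exact ⟨c, hc1, this ▸ j3 c hc2 hc3⟩

theorem isConv_upClosure {C : Set V} (hC : IsConv C) :
    IsConv (upClosure C) := by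
  rw [← opp_downClosure]
  exact @isConv_downClosure V (opp V) C hC

end Lattice

/-! ## Normal cones of finite planar sets -/

section Planar

open MeasureTheory

/-- The linear functional with coefficients `(1 - t, t)`. -/
def score (t : ℝ) (v : ℝ × ℝ) : ℝ := (1 - t) * v.1 + t * v.2

/-- The parameters `t` in `[0, 1]` for which `v` maximizes `score t` over `S`. -/
def supportSet (S : Set (ℝ × ℝ)) (v : ℝ × ℝ) : Set ℝ :=
  {t ∈ Set.Icc 0 1 | ∀ y ∈ S, score t y ≤ score t v}

theorem score_combo (t a b : ℝ) (x y : ℝ × ℝ) :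
    score t (a • x + b • y) = a * score t x + b * score t y := by
  simp [score]; ring

theorem score_le_of_mem_convexHull {S : Set (ℝ × ℝ)} {t r : ℝ} (h : ∀ y ∈ S, score t y ≤ r) :
    ∀ y ∈ convexHull ℝ S, score t y ≤ r := by
  have : convexHull ℝ S ⊆ {y | score t y ≤ r} := convexHull_min h (by
    intro x hx y hy a b ha hb hab
    simp only [Set.mem_ofPred_eq] at *
    rw [score_combo]
    obtain rfl : b = 1 - a := by linarith
    linarith [mul_le_mul_of_nonneg_left hx ha, mul_le_mul_of_nonneg_left hy hb])
  exact this

theorem sin_add_cos_pos {θ : ℝ} (h : θ ∈ Set.Icc 0 (Real.pi / 2)) :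
    0 < Real.sin θ + Real.cos θ := by
  have hpi := Real.pi_pos
  have hc := Real.cos_nonneg_of_mem_Icc (x := θ) ⟨by linarith [h.1], h.2⟩
  have hs := Real.sin_nonneg_of_nonneg_of_le_pi h.1 (by linarith [h.2])
  nlinarith [Real.sin_sq_add_cos_sq θ]

theorem angleWeight_lt_iff {s t : ℝ} (hs : s ∈ Set.Icc 0 (Real.pi / 2))
    (ht : t ∈ Set.Icc 0 (Real.pi / 2)) : angleWeight s < angleWeight t ↔ s < t := by
  have hpi := Real.pi_pos
  have h : angleWeight s < angleWeight t ↔ 0 < Real.sin (t - s) := by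
    rw [angleWeight, angleWeight, div_lt_div_iff₀ (sin_add_cos_pos hs) (sin_add_cos_pos ht),
      Real.sin_sub, ← sub_pos]
    ring_nf
  rw [h]
  constructor
  · intro h'
    by_contra hlt
    have := Real.sin_nonpos_of_nonpos_of_neg_pi_le (x := t - s) (by linarith)
      (by linarith [hs.2, ht.1])
    linarith
  · intro h'
    exact Real.sin_pos_of_pos_of_lt_pi (by linarith) (by linarith [hs.1, ht.2])

theorem angleWeight_strictMonoOn : StrictMonoOn angleWeight (Set.Icc 0 (Real.pi / 2)) :=
  fun _ hs _ ht h => (angleWeight_lt_iff hs ht).2 h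

theorem exists_angleWeight_eq {t : ℝ} (ht : t ∈ Set.Icc (0 : ℝ) 1) :
    ∃ θ ∈ Set.Icc 0 (Real.pi / 2), angleWeight θ = t := by
  have hpi := Real.pi_pos
  have hc : ContinuousOn angleWeight (Set.Icc 0 (Real.pi / 2)) := by
    unfold angleWeight
    exact ContinuousOn.div (by fun_prop) (by fun_prop) fun θ h => (sin_add_cos_pos h).ne'
  have := intermediate_value_Icc (by positivity) hc
  rw [show angleWeight 0 = 0 by simp [angleWeight],
    show angleWeight (Real.pi / 2) = 1 by simp [angleWeight]] at this
  exact this ht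

theorem angleWeight_mem {θ : ℝ} (h : θ ∈ Set.Icc 0 (Real.pi / 2)) :
    angleWeight θ ∈ Set.Icc (0 : ℝ) 1 := by
  have hpi := Real.pi_pos
  have hm := angleWeight_strictMonoOn.monotoneOn
  have h0 := hm ⟨le_rfl, by positivity⟩ h h.1
  have h1 := hm h ⟨by positivity, le_rfl⟩ h.2
  rw [show angleWeight 0 = 0 by simp [angleWeight]] at h0
  rw [show angleWeight (Real.pi / 2) = 1 by simp [angleWeight]] at h1
  exact ⟨h0, h1⟩

theorem isCompact_supportSet (S : Set (ℝ × ℝ)) (v : ℝ × ℝ) : IsCompact (supportSet S v) := by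
  apply isCompact_Icc.inter_right (t := {t | ∀ y ∈ S, score t y ≤ score t v})
  simp only [Set.ofPred_forall]
  exact isClosed_biInter fun y _ => isClosed_le (by unfold score; fun_prop)
    (by unfold score; fun_prop)

theorem convex_supportSet (S : Set (ℝ × ℝ)) (v : ℝ × ℝ) : Convex ℝ (supportSet S v) := by
  intro s hs t ht a b ha hb hab
  refine ⟨convex_Icc 0 1 hs.1 ht.1 ha hb hab, fun y hy => ?_⟩
  have h1 := mul_le_mul_of_nonneg_left (hs.2 y hy) ha
  have h2 := mul_le_mul_of_nonneg_left (ht.2 y hy) hb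
  have e (z : ℝ × ℝ) : score (a • s + b • t) z = a * score s z + b * score t z := by
    simp only [score, smul_eq_mul]
    linear_combination (-z.1) * hab
  rw [e, e]; linarith

/-- Dividing `(cos θ, sin θ)` by `sin θ + cos θ` gives `(1 - t, t)` with `t = angleWeight θ`. As
`angleWeight` is an increasing bijection onto `[0, 1]`, the cone weight is the length of the
interval of parameters `t`. -/
theorem coneWeight_eq_volume {S : Set (ℝ × ℝ)} {v : ℝ × ℝ} (hv : v ∈ S) :
    coneWeight {c : ℝ × ℝ | 0 ≤ c.1 ∧ 0 ≤ c.2 ∧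
      IsGreatest ((fun x : ℝ × ℝ => c.1 * x.1 + c.2 * x.2) '' convexHull ℝ S)
        (c.1 * v.1 + c.2 * v.2)} = volume.real (supportSet S v) := by
  have hpi := Real.pi_pos
  have hA : coneAngles {c : ℝ × ℝ | 0 ≤ c.1 ∧ 0 ≤ c.2 ∧
      IsGreatest ((fun x : ℝ × ℝ => c.1 * x.1 + c.2 * x.2) '' convexHull ℝ S)
        (c.1 * v.1 + c.2 * v.2)} =
      {θ ∈ Set.Icc 0 (Real.pi / 2) | angleWeight θ ∈ supportSet S v} := by
    ext θ
    simp only [coneAngles, Set.mem_ofPred_eq, supportSet]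
    refine and_congr_right fun hθ => ?_
    have hs := sin_add_cos_pos hθ
    have e (y : ℝ × ℝ) : Real.cos θ * y.1 + Real.sin θ * y.2 =
        (Real.sin θ + Real.cos θ) * score (angleWeight θ) y := by
      unfold score angleWeight
      field_simp
      ring
    simp only [e]
    constructor
    · rintro ⟨-, -, -, h⟩
      exact ⟨angleWeight_mem hθ, fun y hy =>
        le_of_mul_le_mul_left (h ⟨y, subset_convexHull ℝ S hy, rfl⟩) hs⟩
    · rintro ⟨-, h⟩
      refine ⟨Real.cos_nonneg_of_mem_Icc ⟨by linarith [hθ.1], hθ.2⟩,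
        Real.sin_nonneg_of_nonneg_of_le_pi hθ.1 (by linarith [hθ.2]),
        ⟨v, subset_convexHull ℝ S hv, rfl⟩, ?_⟩
      rintro _ ⟨y, hy, rfl⟩
      exact mul_le_mul_of_nonneg_left (score_le_of_mem_convexHull h y hy) hs.le
  rw [coneWeight, hA]
  -- For an empty support set, `sSup ∅ = sInf ∅ = 0` makes the two weights cancel.
  rcases (supportSet S v).eq_empty_or_nonempty with he | hne
  · simp [he, angleWeight]
  have hT := eq_Icc_of_connected_compact
    ⟨hne, (convex_supportSet S v).isPreconnected⟩ (isCompact_supportSet S v)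
  set α := sInf (supportSet S v)
  set β := sSup (supportSet S v)
  have hαβ : α ≤ β := by rw [hT] at hne; exact Set.nonempty_Icc.1 hne
  have hsub : Set.Icc α β ⊆ Set.Icc 0 1 := hT ▸ fun t ht => ht.1
  obtain ⟨a, ha, ea⟩ := exists_angleWeight_eq (hsub ⟨le_rfl, hαβ⟩)
  obtain ⟨b, hb, eb⟩ := exists_angleWeight_eq (hsub ⟨hαβ, le_rfl⟩)
  have hm := angleWeight_strictMonoOn
  have hab : a ≤ b := (hm.le_iff_le ha hb).1 (by rw [ea, eb]; exact hαβ)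
  have hI : {θ ∈ Set.Icc 0 (Real.pi / 2) | angleWeight θ ∈ supportSet S v} = Set.Icc a b := by
    ext θ
    rw [Set.mem_ofPred_eq, hT, ← ea, ← eb]
    constructor
    · rintro ⟨hθ, h1, h2⟩
      exact ⟨(hm.le_iff_le ha hθ).1 h1, (hm.le_iff_le hθ hb).1 h2⟩
    · rintro ⟨h1, h2⟩
      have hθ : θ ∈ Set.Icc 0 (Real.pi / 2) := ⟨ha.1.trans h1, h2.trans hb.2⟩
      exact ⟨hθ, (hm.le_iff_le ha hθ).2 h1, (hm.le_iff_le hθ hb).2 h2⟩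
  rw [hI, csSup_Icc hab, csInf_Icc hab, ea, eb, hT, Real.volume_real_Icc_of_le hαβ]

/-- A unique maximizer of a positive functional is a maximal extreme point of the hull. -/
theorem extreme_maximal_of_unique {S : Set (ℝ × ℝ)} {t : ℝ} (h0 : 0 < t) (h1 : t < 1) {v : ℝ × ℝ}
    (hv : v ∈ S) (hu : ∀ y ∈ S, y ≠ v → score t y < score t v) :
    v ∈ Set.extremePoints ℝ (convexHull ℝ S) ∧ Maximal (· ∈ convexHull ℝ S) v := by
  have hull : ∀ y ∈ convexHull ℝ S, y = v ∨ score t y < score t v := by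
    have : convexHull ℝ S ⊆ {y | y = v ∨ score t y < score t v} := by
      refine convexHull_min (fun y hy => ?_) ?_
      · by_cases h : y = v
        · exact Or.inl h
        · exact Or.inr (hu y hy h)
      · intro x hx y hy a b ha hb hab
        have hx' : score t x ≤ score t v := hx.elim (fun h => h ▸ le_rfl) le_of_lt
        have hy' : score t y ≤ score t v := hy.elim (fun h => h ▸ le_rfl) le_of_lt
        simp only [Set.mem_ofPred_eq, score_combo]
        obtain rfl : b = 1 - a := by linarith
        rcases ha.eq_or_lt with rfl | ha
        · simpa using hy
        rcases hb.eq_or_lt with hb | hb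
        · obtain rfl : a = 1 := by linarith
          simpa using hx
        rcases hx with rfl | hx
        · rcases hy with rfl | hy
          · left; rw [← add_smul]; simp
          · right; nlinarith
        · right; nlinarith
    exact this
  refine ⟨⟨subset_convexHull ℝ S hv, ?_⟩, subset_convexHull ℝ S hv, ?_⟩
  · rintro x hx y hy ⟨a, b, ha, hb, hab, he⟩
    rcases hull x hx with h | h
    · exact h
    · exfalso
      have h' : score t y ≤ score t v := (hull y hy).elim (fun h => h ▸ le_rfl) le_of_lt
      have e := score_combo t a b x y
      rw [he] at e
      obtain rfl : b = 1 - a := by linarith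
      nlinarith
  · intro y hy hvy
    rcases hull y hy with h | h
    · exact h.le
    · exfalso
      have := mul_le_mul_of_nonneg_left hvy.1 (by linarith : 0 ≤ 1 - t)
      have := mul_le_mul_of_nonneg_left hvy.2 h0.le
      unfold score at h
      linarith

theorem finite_score_eq {x y : ℝ × ℝ} (h : x ≠ y) : {t | score t x = score t y}.Finite := by
  refine Set.Subsingleton.finite fun s hs t ht => ?_
  simp only [Set.mem_ofPred_eq, score] at hs ht
  by_contra hst
  apply h
  have h1 : (s - t) * ((x.2 - y.2) - (x.1 - y.1)) = 0 := by linear_combination hs - ht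
  have h2 : (x.2 - y.2) - (x.1 - y.1) = 0 :=
    (mul_eq_zero.1 h1).resolve_left (sub_ne_zero.2 hst)
  exact Prod.ext (by linear_combination hs - s * h2) (by linear_combination hs - s * h2 + h2)

open Classical in
/-- The normal cones at the maximal extreme points cover almost all directions exactly once. -/
theorem sum_volume_supportSet (S : Finset (ℝ × ℝ)) (hS : S.Nonempty) :
    ∑ v ∈ S.filter (fun v => v ∈ Set.extremePoints ℝ (convexHull ℝ (S : Set (ℝ × ℝ))) ∧
      Maximal (· ∈ convexHull ℝ (S : Set (ℝ × ℝ))) v), volume.real (supportSet S v) = 1 := by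
  set E := S.filter (fun v => v ∈ Set.extremePoints ℝ (convexHull ℝ (S : Set (ℝ × ℝ))) ∧
      Maximal (· ∈ convexHull ℝ (S : Set (ℝ × ℝ))) v) with hE
  have hmeas (v : ℝ × ℝ) : NullMeasurableSet (supportSet S v) volume :=
    (isCompact_supportSet S v).isClosed.measurableSet.nullMeasurableSet
  have hdisj : (E : Set (ℝ × ℝ)).Pairwise
      (Function.onFun (AEDisjoint volume) (supportSet (S : Set (ℝ × ℝ)))) := by
    intro v hv w hw hvw
    refine ((finite_score_eq hvw).subset fun t ht => ?_).measure_zero volume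
    exact le_antisymm (ht.2.2 v (Finset.mem_filter.1 hv).1) (ht.1.2 w (Finset.mem_filter.1 hw).1)
  have hfin (v : ℝ × ℝ) : volume (supportSet (S : Set (ℝ × ℝ)) v) ≠ ⊤ :=
    (isCompact_supportSet S v).measure_lt_top.ne
  rw [← measureReal_biUnion_finset₀ hdisj (fun v _ => hmeas v) (fun v _ => hfin v)]
  -- The discarded parameters are those with a tie, and the endpoints, where a maximizer need not be
  -- maximal in the componentwise order.
  have hN : (({0, 1} : Set ℝ) ∪ ⋃ x ∈ S, ⋃ y ∈ S, ⋃ (_ : x ≠ y),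
      {t | score t x = score t y}).Finite := by
    refine (Set.toFinite _).union ?_
    exact S.finite_toSet.biUnion fun x _ => S.finite_toSet.biUnion fun y _ =>
      Set.finite_iUnion fun h => finite_score_eq h
  have hae : (⋃ v ∈ E, supportSet (S : Set (ℝ × ℝ)) v) =ᵐ[volume] Set.Icc (0 : ℝ) 1 := by
    have h0 := hN.measure_zero volume
    refine Filter.EventuallyLE.antisymm (Filter.Eventually.of_forall fun t ht => ?_) ?_
    · obtain ⟨v, -, hv⟩ := Set.mem_iUnion₂.1 ht
      exact hv.1
    · filter_upwards [compl_mem_ae_iff.2 h0] with t ht htI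
      simp only [Set.mem_compl_iff, Set.mem_union, Set.mem_iUnion, not_or, not_exists] at ht
      obtain ⟨v, hv, hmax⟩ := S.exists_max_image (score t) hS
      have hne : t ≠ 0 ∧ t ≠ 1 := by simpa using ht.1
      refine Set.mem_iUnion₂.2 ⟨v, Finset.mem_filter.2 ⟨hv, ?_⟩, htI, hmax⟩
      exact extreme_maximal_of_unique (lt_of_le_of_ne htI.1 hne.1.symm)
        (lt_of_le_of_ne htI.2 hne.2) hv fun y hy hyv =>
        lt_of_le_of_ne (hmax y hy) (ht.2 y hy v hv hyv)
  rw [measureReal_congr hae]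
  simp

/-- The topmost point of a finite set of lattice points, rightmost among those, is a maximal extreme
point with a full-dimensional normal cone. -/
theorem top_extreme {S : Set (ℝ × ℝ)} {v : ℝ × ℝ} (hv : v ∈ S) {R : ℝ} (hR : 0 ≤ R)
    (hv0 : 0 ≤ v.1) (hx : ∀ y ∈ S, y.1 ≤ R)
    (hy : ∀ y ∈ S, y ≠ v → y.2 ≤ v.2 - 1 ∨ y.2 = v.2 ∧ y.1 < v.1) :
    (v ∈ Set.extremePoints ℝ (convexHull ℝ S) ∧ Maximal (· ∈ convexHull ℝ S) v) ∧
      0 < volume.real (supportSet S v) := by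
  -- A competitor gains at most `(1 - t) * R` from the first coordinate and, if lower, loses at
  -- least `t` from the second; the loss prevails once `t > R / (R + 1)`.
  have key : ∀ t, R / (R + 1) < t → t < 1 → ∀ y ∈ S, y ≠ v → score t y < score t v := by
    intro t h1 h2 y hyS hne
    rw [div_lt_iff₀ (by linarith)] at h1
    have h0 : 0 ≤ t := by nlinarith
    unfold score
    rcases hy y hyS hne with h | ⟨h, h'⟩
    · nlinarith [mul_le_mul_of_nonneg_left (hx y hyS) (by linarith : 0 ≤ 1 - t),
        mul_le_mul_of_nonneg_left h h0, mul_nonneg (by linarith : 0 ≤ 1 - t) hv0]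
    · rw [h]; nlinarith
  have hr0 : 0 ≤ R / (R + 1) := by positivity
  have hr : R / (R + 1) < 1 := by rw [div_lt_one (by linarith)]; linarith
  obtain ⟨t, ht1, ht2⟩ := exists_between hr
  refine ⟨extreme_maximal_of_unique (by linarith) ht2 hv (key t ht1 ht2), ?_⟩
  have hsub : Set.Ioo (R / (R + 1)) 1 ⊆ supportSet S v := fun t ht =>
    ⟨⟨by linarith [ht.1], ht.2.le⟩, fun y hyS => by
      by_cases h : y = v
      · rw [h]
      · exact (key t ht.1 ht.2 y hyS h).le⟩
  refine lt_of_lt_of_le ?_ (measureReal_mono hsub (isCompact_supportSet S v).measure_lt_top.ne)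
  rw [Real.volume_real_Ioo_of_le hr.le]
  linarith

end Planar

/-! ## Fractional joins -/

section FracJoin

open OrientedModularGraph MeasureTheory

variable {V : Type*} [OrientedModularGraph V]

/-- The consequence of submodularity on the filters of `V` that steepest descent relies on: for
`p`, `q` with meet `m` the inequality `g m + ∑ c u * g u ≤ g p + g q` for a convex combination of
maximal joins `u` of elements of `[m, p]` and `[m, q]`, one of which dominates `q` and every
element of `[m, p]` that is bounded together with `q`. -/
def HasFracJoin (g : V → WithTop ℝ) : Prop :=
  ∀ m p q : V, IsGLB {p, q} m → g p ≠ ⊤ → g q ≠ ⊤ → g m ≠ ⊤ ∧ ∃ (E : Finset V) (c : V → ℝ),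
    (∀ u ∈ E, 0 < c u ∧ g u ≠ ⊤ ∧ ∃ a b, m ≤ a ∧ a ≤ p ∧ m ≤ b ∧ b ≤ q ∧ IsLUB {a, b} u ∧
      ∀ a' b' u', a ≤ a' → a' ≤ p → b ≤ b' → b' ≤ q → IsLUB {a', b'} u' → u' = u) ∧
    ∑ u ∈ E, c u = 1 ∧
    (g m).untopD 0 + ∑ u ∈ E, c u * (g u).untopD 0 ≤ (g p).untopD 0 + (g q).untopD 0 ∧
    ∀ a d, m ≤ a → a ≤ p → a ≤ d → q ≤ d → ∃ u ∈ E, a ≤ u ∧ q ≤ u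

/-- Distance from `m` is strictly increasing on the filter, which bounds the height above;
descending along arcs to `m` gives a chain of that length. -/
theorem rank_Ici {m : V} (y : Set.Ici m) : rank y = dst m y := by
  have hmono : StrictMono (fun y : Set.Ici m => dst m (y : V)) := by
    intro y z hyz
    have hyz' : (y : V) < z := hyz
    have h1 := btw_of_le y.2 hyz'.le
    have h2 : dst (y : V) z ≠ 0 := fun h => hyz'.ne (dst_eq_zero.1 h)
    unfold Btw at h1
    change dst m (y : V) < dst m (z : V)
    omega
  have hle : Order.height y ≤ (dst m (y : V) : ℕ∞) := by
    simpa using Order.height_le_height_apply_of_strictMono _ hmono y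
  have hge : ∀ n : ℕ, ∀ y : Set.Ici m, dst m (y : V) = n → (n : ℕ∞) ≤ Order.height y := by
    intro n
    induction n with
    | zero => simp
    | succ n ih =>
      intro y hy
      rcases Relation.ReflTransGen.cases_head (show Relation.ReflTransGen arc (y : V) m from y.2)
        with h | ⟨r, hr, hrx⟩
      · rw [h] at hy; simp at hy
      have hmr : m ≤ r := hrx
      have e := dst_arc_le hmr hr
      have hlt : (⟨r, hmr⟩ : Set.Ici m) < y := by
        refine lt_of_le_of_ne (le_of_arc hr) fun h => ?_
        rw [← h] at e
        simp at e
      have := ih ⟨r, hmr⟩ (by change dst m r = n; omega)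
      calc ((n + 1 : ℕ) : ℕ∞) = (n : ℕ∞) + 1 := by push_cast; rfl
        _ ≤ Order.height (⟨r, hmr⟩ : Set.Ici m) + 1 := by gcongr
        _ ≤ _ := Order.height_add_one_le hlt
  rw [rank, le_antisymm hle (hge _ y rfl)]
  rfl

theorem meet_eq_of_isGLB {L : Type*} [PartialOrder L] {p q m : L} (h : IsGLB {p, q} m) :
    meet p q = m := by
  have h' : ∃ m, IsGLB {p, q} m := ⟨m, h⟩
  rw [meet, dif_pos h']
  exact h'.choose_spec.unique h

theorem isGLB_Ici {m : V} {p q c : Set.Ici m} (h : IsGLB {(p : V), (q : V)} (c : V)) :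
    IsGLB {p, q} c := by
  obtain ⟨h1, h2, h3⟩ := isGLB_pair_iff.1 h
  exact isGLB_pair_iff.2 ⟨h1, h2, fun d d1 d2 => h3 d d1 d2⟩

theorem isLUB_Ici {m : V} {p q c : Set.Ici m} :
    IsLUB {p, q} c ↔ IsLUB {(p : V), (q : V)} (c : V) := by
  rw [isLUB_pair_iff, isLUB_pair_iff]
  refine and_congr Iff.rfl (and_congr Iff.rfl ⟨fun h d d1 d2 => ?_, fun h d d1 d2 => h d d1 d2⟩)
  exact h ⟨d, p.2.trans d1⟩ d1 d2

/-! ### The sets `I(p, q)` and `E(p, q)` inside a filter. -/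

section Pair

variable {m p q : V}

/-- Membership in `I(p, q)`, in terms of the ambient order. -/
theorem mem_joinSet_iff (hm : IsGLB {p, q} m) {P Q u : Set.Ici m} (hP : (P : V) = p)
    (hQ : (Q : V) = q) :
    u ∈ joinSet P Q ↔ ∃ a b, m ≤ a ∧ a ≤ p ∧ m ≤ b ∧ b ≤ q ∧ IsLUB {a, b} (u : V) := by
  have e : meet P Q = ⟨m, Set.self_mem_Ici⟩ := meet_eq_of_isGLB (isGLB_Ici (by rwa [hP, hQ]))
  unfold joinSet
  rw [e]
  constructor
  · rintro ⟨a, ⟨a1, a2⟩, b, ⟨b1, b2⟩, h⟩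
    exact ⟨a, b, a1, hP ▸ a2, b1, hQ ▸ b2, isLUB_Ici.1 h⟩
  · rintro ⟨a, b, a1, a2, b1, b2, h⟩
    refine ⟨⟨a, a1⟩, ⟨a1, ?_⟩, ⟨b, b1⟩, ⟨b1, ?_⟩, isLUB_Ici.2 h⟩
    · rw [← Subtype.coe_le_coe, hP]; exact a2
    · rw [← Subtype.coe_le_coe, hQ]; exact b2

theorem rankVec_eq (hm : IsGLB {p, q} m) {P Q u : Set.Ici m} (hP : (P : V) = p)
    (hQ : (Q : V) = q) {a b : V} (a1 : m ≤ a) (a2 : a ≤ p) (b1 : m ≤ b) (b2 : b ≤ q)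
    (hu : IsLUB {a, b} (u : V)) : rankVec P Q u = ((dst m a : ℝ), (dst m b : ℝ)) := by
  have e : meet P Q = ⟨m, Set.self_mem_Ici⟩ := meet_eq_of_isGLB (isGLB_Ici (by rwa [hP, hQ]))
  have ea : meet u P = ⟨a, a1⟩ :=
    meet_eq_of_isGLB (isGLB_Ici (by rw [hP]; exact isGLB_join_left hm a1 a2 b1 b2 hu))
  have eb : meet u Q = ⟨b, b1⟩ :=
    meet_eq_of_isGLB (isGLB_Ici (by rw [hQ]; exact isGLB_join_right hm a1 a2 b1 b2 hu))
  rw [rankVec, e, ea, eb]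
  simp [rank_Ici]

/-- For `u = a ∨ b` and `u' = a' ∨ b'` with the same vector, the pairs `(a ∨ a', b ∧ b')` and `(a ∧
a', b ∨ b')` also have joins, and the common vector is the midpoint of theirs. Extremality makes all
these ranks agree, so `a = a'` and `b = b'`. -/
theorem rankVec_injOn (hm : IsGLB {p, q} m) {P Q : Set.Ici m} (hP : (P : V) = p)
    (hQ : (Q : V) = q) : Set.InjOn (rankVec P Q) (extremeJoins P Q) := by
  rintro u hu u' hu' he
  obtain ⟨a, b, a1, a2, b1, b2, h⟩ := (mem_joinSet_iff hm hP hQ).1 hu.1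
  obtain ⟨a', b', a1', a2', b1', b2', h'⟩ := (mem_joinSet_iff hm hP hQ).1 hu'.1
  have ev := rankVec_eq hm hP hQ a1 a2 b1 b2 h
  have ev' := rankVec_eq hm hP hQ a1' a2' b1' b2' h'
  obtain ⟨hda, hdb⟩ := Prod.mk.inj (ev.symm.trans (he.trans ev'))
  rw [Nat.cast_inj] at hda hdb
  obtain ⟨hau, hbu, -⟩ := isLUB_pair_iff.1 h
  obtain ⟨hau', hbu', -⟩ := isLUB_pair_iff.1 h'
  obtain ⟨aj, haj⟩ := exists_isLUB a2 a2'
  obtain ⟨am, ham⟩ := exists_isGLB a1 a1'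
  obtain ⟨bj, hbj⟩ := exists_isLUB b2 b2'
  obtain ⟨bm, hbm⟩ := exists_isGLB b1 b1'
  have tr {x x' y z : V} (hx : m ≤ x) (hx' : m ≤ x') (hz : IsGLB {x, x'} z) (hy : IsLUB {x, x'} y)
      (hd : dst m x = dst m x') : dst m y + dst m z = 2 * dst m x ∧ m ≤ z ∧ x ≤ y ∧ x' ≤ y := by
    obtain ⟨z1, z2, z3⟩ := isGLB_pair_iff.1 hz
    obtain ⟨y1, y2, -⟩ := isLUB_pair_iff.1 hy
    have h1 := dst_transpose hz hy
    have hmz := z3 m hx hx'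
    have h2 := btw_of_le hmz z1
    have h3 := btw_of_le hmz z2
    have h4 := btw_of_le hx y1
    have h5 := btw_of_le hx' y2
    unfold Btw at *
    exact ⟨by omega, hmz, y1, y2⟩
  obtain ⟨ta, hmam, haaj, haaj'⟩ := tr a1 a1' ham haj hda
  obtain ⟨tb, hmbm, hbbj, hbbj'⟩ := tr b1 b1' hbm hbj hdb
  have hajp : aj ≤ p := (isLUB_pair_iff.1 haj).2.2 p a2 a2'
  have hbjq : bj ≤ q := (isLUB_pair_iff.1 hbj).2.2 q b2 b2'
  obtain ⟨amu, amu', -⟩ := isGLB_pair_iff.1 ham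
  obtain ⟨bmu, bmu', -⟩ := isGLB_pair_iff.1 hbm
  have mk {s t d : V} (s1 : m ≤ s) (s2 : s ≤ p) (t1 : m ≤ t) (t2 : t ≤ q) (hs : s ≤ d)
      (ht : t ≤ d) : ((dst m s : ℝ), (dst m t : ℝ)) ∈ convJoin P Q := by
    obtain ⟨w, hw⟩ := exists_isLUB hs ht
    have hmw := s1.trans (isLUB_pair_iff.1 hw).1
    have hv := rankVec_eq (u := ⟨w, hmw⟩) hm hP hQ s1 s2 t1 t2 hw
    rw [← hv]
    exact subset_convexHull ℝ _
      ⟨_, (mem_joinSet_iff hm hP hQ).2 ⟨s, t, s1, s2, t1, t2, hw⟩, rfl⟩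
  -- The elements `a`, `a'`, `b ∧ b'` are pairwise bounded, by `p`, `u'` and `u`.
  obtain ⟨d, d1, d2, d3⟩ := exists_upper_bound a2 a2' hau' (bmu'.trans hbu') hau (bmu.trans hbu)
  obtain ⟨d', d1', d2', d3'⟩ :=
    exists_upper_bound b2 b2' hbu' (amu'.trans hau') hbu (amu.trans hau)
  have k1 := mk (a1.trans haaj) hajp hmbm (bmu.trans b2) ((isLUB_pair_iff.1 haj).2.2 d d1 d2) d3
  have k2 := mk hmam (amu.trans a2) (b1.trans hbbj) hbjq d3'
    ((isLUB_pair_iff.1 hbj).2.2 d' d1' d2')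
  have hseg : rankVec P Q u ∈ openSegment ℝ ((dst m aj : ℝ), (dst m bm : ℝ))
      ((dst m am : ℝ), (dst m bj : ℝ)) := by
    refine ⟨1 / 2, 1 / 2, by norm_num, by norm_num, by norm_num, ?_⟩
    rw [ev]
    have ta' : (dst m aj : ℝ) + dst m am = 2 * dst m a := by exact_mod_cast ta
    have tb' : (dst m bj : ℝ) + dst m bm = 2 * dst m b := by exact_mod_cast tb
    ext
    · simp; linarith
    · simp; linarith
  have hex := hu.2.1.2 k1 k2 hseg
  rw [ev] at hex
  obtain ⟨e1, e2⟩ := Prod.mk.inj hex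
  rw [Nat.cast_inj] at e1 e2
  have haa' : a = a' := (eq_of_le_of_dst a1 haaj e1.le).trans
    (eq_of_le_of_dst a1' haaj' (by omega)).symm
  have hbb' : b = b' := (eq_of_le_of_dst b1 hbbj (by omega)).trans
    (eq_of_le_of_dst b1' hbbj' (by omega)).symm
  subst haa' hbb'
  exact Subtype.ext (h.unique h')

end Pair

theorem withTop_mul_eq {c : ℝ} {y : WithTop ℝ} (h : c ≠ 0 → y ≠ ⊤) :
    (c : WithTop ℝ) * y = ((c * y.untopD 0 : ℝ) : WithTop ℝ) := by
  by_cases hc : c = 0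
  · subst hc; simp
  · lift y to ℝ using h hc
    simp

theorem ne_top_of_mul {c : ℝ} {y : WithTop ℝ} (hc : c ≠ 0) (h : (c : WithTop ℝ) * y ≠ ⊤) :
    y ≠ ⊤ := by
  rintro rfl
  exact h (WithTop.mul_top (by exact_mod_cast hc))

theorem finite_rankVec_image {m p q : V} (hm : IsGLB {p, q} m) {P Q : Set.Ici m}
    (hP : (P : V) = p) (hQ : (Q : V) = q) : (rankVec P Q '' joinSet P Q).Finite := by
  refine (((Set.finite_Iic (dst m p)).prod (Set.finite_Iic (dst m q))).image
    fun ij : ℕ × ℕ => ((ij.1 : ℝ), (ij.2 : ℝ))).subset ?_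
  rintro _ ⟨u, hu, rfl⟩
  obtain ⟨a, b, a1, a2, b1, b2, h⟩ := (mem_joinSet_iff hm hP hQ).1 hu
  exact ⟨(dst m a, dst m b), ⟨dst_mono a1 a2, dst_mono b1 b2⟩,
    (rankVec_eq hm hP hQ a1 a2 b1 b2 h).symm⟩

open Classical in
/-- Submodularity on the filters of `V` yields fractional joins. -/
theorem hasFracJoin_of_isSubmodular {g : V → WithTop ℝ}
    (hg : ∀ x : V, IsSubmodular (fun p : Set.Ici x => g p)) : HasFracJoin g := by
  intro m p q hm hp hq
  obtain ⟨hmp, hmq, -⟩ := isGLB_pair_iff.1 hm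
  obtain ⟨P, hP⟩ : ∃ P : Set.Ici m, (P : V) = p := ⟨⟨p, hmp⟩, rfl⟩
  obtain ⟨Q, hQ⟩ : ∃ Q : Set.Ici m, (Q : V) = q := ⟨⟨q, hmq⟩, rfl⟩
  have hmem (u : Set.Ici m) := mem_joinSet_iff (u := u) hm hP hQ
  have hvec {u : Set.Ici m} {a b : V} := rankVec_eq (u := u) (a := a) (b := b) hm hP hQ
  have e : meet P Q = ⟨m, Set.self_mem_Ici⟩ := meet_eq_of_isGLB (isGLB_Ici (by rwa [hP, hQ]))
  obtain ⟨S, hS⟩ := (finite_rankVec_image hm hP hQ).exists_finset_coe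
  set w : Set.Ici m → ℝ := fun u => volume.real (supportSet (S : Set (ℝ × ℝ)) (rankVec P Q u))
    with hw
  have hinj := rankVec_injOn hm hP hQ
  have hfin : (extremeJoins P Q).Finite := by
    refine Set.Finite.of_finite_image ((S.finite_toSet).subset ?_) hinj
    rw [hS]
    exact Set.image_mono fun u hu => hu.1
  have hcw : ∀ u ∈ hfin.toFinset, coneWeight (normalCone P Q u) = w u := by
    intro u hu
    rw [hfin.mem_toFinset] at hu
    have := coneWeight_eq_volume (S := (S : Set (ℝ × ℝ))) (v := rankVec P Q u)
      (by rw [hS]; exact ⟨u, hu.1, rfl⟩)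
    rw [hS] at this
    rw [hw, normalCone, convJoin, this, hS]
  have hsum : ∑ u ∈ hfin.toFinset, w u = 1 := by
    have hne : S.Nonempty := by
      rw [← Finset.coe_nonempty, hS]
      exact ⟨_, P, (hmem P).2 ⟨p, m, hmp, le_rfl, le_rfl, hmq, by
        rw [hP]; exact isLUB_pair_iff.2 ⟨le_rfl, hmp, fun c hc _ => hc⟩⟩, rfl⟩
    rw [← sum_volume_supportSet S hne, hw]
    refine Finset.sum_bij (fun u _ => rankVec P Q u) ?_ ?_ ?_ fun _ _ => rfl
    · intro u hu
      rw [hfin.mem_toFinset] at hu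
      rw [Finset.mem_filter, ← Finset.mem_coe, hS]
      exact ⟨⟨u, hu.1, rfl⟩, hu.2⟩
    · intro u hu u' hu'
      rw [hfin.mem_toFinset] at hu hu'
      exact hinj hu hu'
    · intro v hv
      rw [Finset.mem_filter, ← Finset.mem_coe, hS] at hv
      obtain ⟨⟨u, hu, rfl⟩, h⟩ := hv
      exact ⟨u, hfin.mem_toFinset.2 ⟨hu, h⟩, rfl⟩
  have hineq := hg m P Q
  rw [finsum_mem_eq_finite_toFinset_sum _ hfin, e] at hineq
  change g m + ∑ u ∈ hfin.toFinset, (coneWeight (normalCone P Q u) : WithTop ℝ) * g u ≤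
    g P + g Q at hineq
  rw [hP, hQ, Finset.sum_congr rfl fun u hu => by rw [hcw u hu]] at hineq
  have htop := ne_top_of_le_ne_top (WithTop.add_ne_top.2 ⟨hp, hq⟩) hineq
  obtain ⟨hgm, htop⟩ := WithTop.add_ne_top.1 htop
  rw [WithTop.sum_ne_top] at htop
  have hgu : ∀ u ∈ hfin.toFinset, w u ≠ 0 → g u ≠ ⊤ := fun u hu h => ne_top_of_mul h (htop u hu)
  rw [Finset.sum_congr rfl fun u hu => withTop_mul_eq (hgu u hu)] at hineq
  -- Joins of weight zero are dropped, since `g` may be infinite there.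
  refine ⟨hgm, (hfin.toFinset.filter fun u => 0 < w u).map ⟨Subtype.val, Subtype.val_injective⟩,
    Function.extend Subtype.val w 0, ?_, ?_, ?_, ?_⟩
  · intro u hu
    obtain ⟨u, hu', rfl⟩ := Finset.mem_map.1 hu
    clear hu
    obtain ⟨hu, hwu⟩ := Finset.mem_filter.1 hu'
    simp only [Function.Embedding.coeFn_mk, Subtype.val_injective.extend_apply]
    refine ⟨hwu, hgu u hu hwu.ne', ?_⟩
    rw [hfin.mem_toFinset] at hu
    obtain ⟨a, b, a1, a2, b1, b2, h⟩ := (hmem u).1 hu.1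
    refine ⟨a, b, a1, a2, b1, b2, h, fun a' b' u' haa' ha' hbb' hb' h' => ?_⟩
    have ha1 := a1.trans haa'
    have hb1 := b1.trans hbb'
    have hmu := ha1.trans (isLUB_pair_iff.1 h').1
    have e1 := hvec a1 a2 b1 b2 h
    have e2 := hvec (u := ⟨u', hmu⟩) ha1 ha' hb1 hb' h'
    -- A larger pair has a larger rank vector, so maximality of the vector of `u` forces equal ranks
    -- and thus equal pairs.
    have hle : rankVec P Q u ≤ rankVec P Q ⟨u', hmu⟩ := by
      rw [e1, e2]
      exact ⟨Nat.cast_le.2 (dst_mono a1 haa'), Nat.cast_le.2 (dst_mono b1 hbb')⟩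
    have hge := hu.2.2.2 (subset_convexHull ℝ _
      ⟨_, (hmem ⟨u', hmu⟩).2 ⟨a', b', ha1, ha', hb1, hb', h'⟩, rfl⟩) hle
    rw [e1, e2] at hge
    have haa := eq_of_le_of_dst a1 haa' (Nat.cast_le.1 hge.1)
    have hbb := eq_of_le_of_dst b1 hbb' (Nat.cast_le.1 hge.2)
    subst haa hbb
    exact h'.unique h
  · rw [Finset.sum_map, ← hsum]
    simp only [Function.Embedding.coeFn_mk, Subtype.val_injective.extend_apply]
    exact Finset.sum_filter_of_ne fun u _ h => lt_of_le_of_ne measureReal_nonneg h.symm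
  · rw [Finset.sum_map]
    simp only [Function.Embedding.coeFn_mk, Subtype.val_injective.extend_apply]
    have hpos : ∑ u ∈ hfin.toFinset with 0 < w u, w u * (g u).untopD 0 =
        ∑ u ∈ hfin.toFinset, w u * (g u).untopD 0 :=
      Finset.sum_filter_of_ne fun u _ h =>
        lt_of_le_of_ne measureReal_nonneg (left_ne_zero_of_mul h).symm
    rw [hpos]
    lift g p to ℝ using hp with gp
    lift g q to ℝ using hq with gq
    lift g m to ℝ using hgm with gm
    simp only [WithTop.untopD_coe]
    rw [← WithTop.coe_sum] at hineq
    exact_mod_cast hineq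
  · intro a0 d a01 a02 had hqd
    -- The dominating join maximizes the rank of the part below `q` first, then the rank of the part
    -- below `p`. As `q` itself is a join, the part below `q` is all of `q`.
    obtain ⟨v, hv, hvmax⟩ := S.exists_max_image (fun v => toLex (v.2, v.1)) (by
      rw [← Finset.coe_nonempty, hS]
      exact ⟨_, P, (hmem P).2 ⟨p, m, hmp, le_rfl, le_rfl, hmq, by
        rw [hP]; exact isLUB_pair_iff.2 ⟨le_rfl, hmp, fun c hc _ => hc⟩⟩, rfl⟩)
    have hmemS (v : ℝ × ℝ) : v ∈ S ↔ v ∈ rankVec P Q '' joinSet P Q := by rw [← hS]; rfl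
    obtain ⟨u, hu, rfl⟩ := (hmemS v).1 hv
    obtain ⟨a, b, a1, a2, b1, b2, h⟩ := (hmem u).1 hu
    have eu := hvec a1 a2 b1 b2 h
    have hmax' : ∀ a' b' u', m ≤ a' → a' ≤ p → m ≤ b' → b' ≤ q → IsLUB {a', b'} u' →
        dst m b' < dst m b ∨ dst m b' = dst m b ∧ dst m a' ≤ dst m a := by
      intro a' b' u' ha1 ha2 hb1 hb2 h'
      have hmu := ha1.trans (isLUB_pair_iff.1 h').1
      have e2 := hvec (u := ⟨u', hmu⟩) ha1 ha2 hb1 hb2 h'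
      have := hvmax _ ((hmemS _).2 ⟨⟨u', hmu⟩, (hmem _).2 ⟨a', b', ha1, ha2, hb1, hb2, h'⟩, rfl⟩)
      rw [eu, e2, Prod.Lex.toLex_le_toLex] at this
      simpa using this
    have hbq : b = q := by
      have := hmax' m q q le_rfl hmp hmq le_rfl
        (isLUB_pair_iff.2 ⟨hmq, le_rfl, fun c _ hc => hc⟩)
      exact eq_of_le_of_dst b1 b2 (by omega)
    subst hbq
    obtain ⟨hau, hbu, -⟩ := isLUB_pair_iff.1 h
    have hau0 : a0 ≤ a := by
      obtain ⟨j, hj⟩ := exists_isLUB a2 a02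
      obtain ⟨j1, j2, j3⟩ := isLUB_pair_iff.1 hj
      -- Here `a`, `a0` and `q` (now called `b`) are pairwise bounded, so `a ∨ a0` could replace
      -- `a`; by the choice of `a` it equals `a`.
      obtain ⟨c, c1, c2, c3⟩ := exists_upper_bound a2 a02 had hqd hau hbu
      obtain ⟨t, ht⟩ := exists_isLUB (j3 c c1 c2) c3
      have := hmax' j b t (a1.trans j1) (j3 p a2 a02) hmq le_rfl ht
      rwa [eq_of_le_of_dst a1 j1 (by omega)]
    have htop : (rankVec P Q u ∈ Set.extremePoints ℝ (convexHull ℝ (S : Set (ℝ × ℝ))) ∧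
        Maximal (· ∈ convexHull ℝ (S : Set (ℝ × ℝ))) (rankVec P Q u)) ∧ 0 < w u := by
      have hall : ∀ y ∈ (S : Set (ℝ × ℝ)), ∃ i j : ℕ, y = ((i : ℝ), (j : ℝ)) ∧ i ≤ dst m p ∧
          (j < dst m b ∨ j = dst m b ∧ i ≤ dst m a) := by
        intro y hy
        obtain ⟨u', hu', rfl⟩ := (hmemS y).1 hy
        obtain ⟨a', b', a1', a2', b1', b2', h'⟩ := (hmem u').1 hu'
        exact ⟨dst m a', dst m b', hvec a1' a2' b1' b2' h', dst_mono a1' a2',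
          hmax' a' b' u' a1' a2' b1' b2' h'⟩
      refine top_extreme (R := dst m p) hv (Nat.cast_nonneg _) (by rw [eu]; positivity) ?_ ?_
      · intro y hy
        obtain ⟨i, j, rfl, hi, -⟩ := hall y hy
        exact Nat.cast_le.2 hi
      · intro y hy hne
        obtain ⟨i, j, rfl, hi, hj | ⟨rfl, hj⟩⟩ := hall y hy
        · left
          rw [eu]
          have : ((j + 1 : ℕ) : ℝ) ≤ dst m b := Nat.cast_le.2 hj
          push_cast at this
          simp only
          linarith
        · right
          rw [eu] at hne ⊢
          refine ⟨rfl, Nat.cast_lt.2 (lt_of_le_of_ne hj ?_)⟩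
          rintro rfl
          exact hne rfl
    refine ⟨u, Finset.mem_map.2 ⟨u, Finset.mem_filter.2 ⟨hfin.mem_toFinset.2 ⟨hu, ?_⟩, htop.2⟩, rfl⟩,
      hau0.trans hau, hbu⟩
    have := htop.1
    rw [hS] at this
    exact this

theorem isSubmodular_opp {g : V → WithTop ℝ} {x : V}
    (hg : IsSubmodular fun p : (Set.Iic x)ᵒᵈ => g (OrderDual.ofDual p : Set.Iic x)) :
    @IsSubmodular (@Set.Ici V (oppOrder V).toPreorder x) (@Subtype.partialOrder V (oppOrder V) _)
      fun p => g p := by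
  -- The filter of `opp V` is only propositionally the ideal of `V`; generalizing the carrier
  -- permits the substitution.
  have key : ∀ A : Set V, A = Set.Iic x →
      @IsSubmodular A (@Subtype.partialOrder V (oppOrder V) _) fun p => g p := by
    rintro A rfl
    have : (@Subtype.partialOrder V (oppOrder V) (· ∈ Set.Iic x)) =
        (inferInstance : PartialOrder (Set.Iic x)ᵒᵈ) :=
      PartialOrder.ext fun _ _ => opp_le
    rw [this]
    exact hg
  exact key _ (opp_Ici x)

/-- The properties of L-convex functions that steepest descent relies on. -/
structure IsFracConvex (g : V → WithTop ℝ) : Prop where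
  up : HasFracJoin g
  down : @HasFracJoin V (opp V) g
  chain : IsChainConnected (dom g)

theorem IsLConvex.isFracConvex {g : V → WithTop ℝ} (hg : IsLConvex g) : IsFracConvex g where
  up := hasFracJoin_of_isSubmodular hg.submodular_filter
  down := @hasFracJoin_of_isSubmodular V (opp V) g fun x => isSubmodular_opp (hg.submodular_ideal x)
  chain := hg.chainConnected

theorem opp_isChainConnected {X : Set V} :
    @IsChainConnected V (opp V) X ↔ IsChainConnected X := by
  have : (fun a b : V => a ∈ X ∧ b ∈ X ∧ ((oppOrder V).le a b ∨ (oppOrder V).le b a)) =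
      fun a b : V => a ∈ X ∧ b ∈ X ∧ (a ≤ b ∨ b ≤ a) := by
    funext a b
    rw [opp_le, opp_le, or_comm]
  unfold IsChainConnected
  rw [this]

theorem IsFracConvex.opp {g : V → WithTop ℝ} (hg : IsFracConvex g) :
    @IsFracConvex V (opp V) g :=
  @IsFracConvex.mk V (LConvex.opp V) g hg.down hg.up (opp_isChainConnected.2 hg.chain)

/-- The dual of `HasFracJoin`. -/
theorem IsFracConvex.meets {g : V → WithTop ℝ} (hg : IsFracConvex g) {m p q : V}
    (hm : IsLUB {p, q} m) (hp : g p ≠ ⊤) (hq : g q ≠ ⊤) :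
    g m ≠ ⊤ ∧ ∃ (E : Finset V) (c : V → ℝ),
    (∀ u ∈ E, 0 < c u ∧ g u ≠ ⊤ ∧ ∃ a b, a ≤ m ∧ p ≤ a ∧ b ≤ m ∧ q ≤ b ∧ IsGLB {a, b} u) ∧
    ∑ u ∈ E, c u = 1 ∧
    (g m).untopD 0 + ∑ u ∈ E, c u * (g u).untopD 0 ≤ (g p).untopD 0 + (g q).untopD 0 ∧
    ∀ a d, a ≤ m → p ≤ a → d ≤ a → d ≤ q → ∃ u ∈ E, u ≤ a ∧ u ≤ q := by
  obtain ⟨h1, E, c, h2, h3, h4, h5⟩ := hg.down m p q (opp_isGLB.2 hm) hp hq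
  refine ⟨h1, E, c, fun u hu => ?_, h3, h4, fun a d ha1 ha2 hd1 hd2 => ?_⟩
  · obtain ⟨hc, hu, a, b, a1, a2, b1, b2, h, -⟩ := h2 u hu
    exact ⟨hc, hu, a, b, opp_le.1 a1, opp_le.1 a2, opp_le.1 b1, opp_le.1 b2, opp_isLUB.1 h⟩
  · obtain ⟨u, hu, h, h'⟩ := h5 a d (opp_le.2 ha1) (opp_le.2 ha2) (opp_le.2 hd1) (opp_le.2 hd2)
    exact ⟨u, hu, opp_le.1 h, opp_le.1 h'⟩

end FracJoin

/-! ## Zigzag balls -/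

section Zigzag

open OrientedModularGraph

variable {V : Type*} [OrientedModularGraph V]

/-- The vertices reached from `x` inside `X` by `k` alternately ascending and descending steps, the
last of them ascending (`true`) or descending (`false`). -/
def zigIn (X : Set V) (x : V) : Bool → ℕ → Set V
  | _, 0 => {x}
  | true, k + 1 => upClosure (zigIn X x false k) ∩ X
  | false, k + 1 => downClosure (zigIn X x true k) ∩ X

/-- The vertices reached from `x` by zigzags with `k` steps. -/
def zigBall (x : V) (b : Bool) (k : ℕ) : Set V := zigIn Set.univ x b k

theorem zigBall_zero (x : V) (b : Bool) : zigBall x b 0 = {x} := by cases b <;> rfl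

theorem zigBall_true_succ (x : V) (k : ℕ) :
    zigBall x true (k + 1) = upClosure (zigBall x false k) := Set.inter_univ _

theorem zigBall_false_succ (x : V) (k : ℕ) :
    zigBall x false (k + 1) = downClosure (zigBall x true k) := Set.inter_univ _

theorem zigIn_zero (X : Set V) (x : V) (b : Bool) : zigIn X x b 0 = {x} := by cases b <;> rfl

theorem opp_zigIn (X : Set V) (x : V) (b : Bool) (k : ℕ) :
    @zigIn V (opp V) X x b k = zigIn X x (!b) k := by
  induction k generalizing b with
  | zero => exact (@zigIn_zero V (opp V) X x b).trans (zigIn_zero X x (!b)).symm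
  | succ k ih =>
    cases b
    · change @downClosure V (opp V) (@zigIn V (opp V) X x true k) ∩ X = _
      rw [opp_downClosure, ih]; rfl
    · change @upClosure V (opp V) (@zigIn V (opp V) X x false k) ∩ X = _
      rw [opp_upClosure, ih]; rfl

theorem opp_zigBall (x : V) (b : Bool) (k : ℕ) :
    @zigBall V (opp V) x b k = zigBall x (!b) k := opp_zigIn _ _ _ _

theorem zigIn_subset {X : Set V} {x : V} (hx : x ∈ X) (b : Bool) (k : ℕ) : zigIn X x b k ⊆ X := by
  cases k with
  | zero => rw [zigIn_zero]; exact Set.singleton_subset_iff.2 hx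
  | succ k => cases b <;> exact Set.inter_subset_right

theorem zigIn_subset_succ {X : Set V} {x : V} (hx : x ∈ X) (b b' : Bool) (k : ℕ) :
    zigIn X x b k ⊆ zigIn X x b' (k + 1) := by
  induction k generalizing b b' with
  | zero =>
    rw [zigIn_zero, Set.singleton_subset_iff]
    cases b' <;> exact ⟨⟨x, rfl, le_rfl⟩, hx⟩
  | succ k ih =>
    intro w hw
    have hwX := zigIn_subset hx _ _ hw
    cases b <;> cases b'
    · obtain ⟨⟨t, ht, h⟩, -⟩ := hw
      exact ⟨⟨t, ih _ _ ht, h⟩, hwX⟩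
    · exact ⟨⟨w, hw, le_rfl⟩, hwX⟩
    · exact ⟨⟨w, hw, le_rfl⟩, hwX⟩
    · obtain ⟨⟨t, ht, h⟩, -⟩ := hw
      exact ⟨⟨t, ih _ _ ht, h⟩, hwX⟩

theorem zigIn_subset_add {X : Set V} {x : V} (hx : x ∈ X) (b b' : Bool) (k n : ℕ) :
    zigIn X x b k ⊆ zigIn X x b' (k + (n + 1)) := by
  induction n generalizing b' with
  | zero => exact zigIn_subset_succ hx b b' k
  | succ n ih => exact (ih b').trans (zigIn_subset_succ hx b' b' _)

theorem zigBall_subset_succ (x : V) (b b' : Bool) (k : ℕ) :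
    zigBall x b k ⊆ zigBall x b' (k + 1) := zigIn_subset_succ (Set.mem_univ x) b b' k

theorem zigIn_subset_zigBall (X : Set V) (x : V) (b : Bool) (k : ℕ) :
    zigIn X x b k ⊆ zigBall x b k := by
  induction k generalizing b with
  | zero => rw [zigIn_zero, zigBall_zero]
  | succ k ih =>
    cases b
    · rintro w ⟨⟨t, ht, h⟩, -⟩
      exact ⟨⟨t, ih _ ht, h⟩, trivial⟩
    · rintro w ⟨⟨t, ht, h⟩, -⟩
      exact ⟨⟨t, ih _ ht, h⟩, trivial⟩

theorem mem_zigBall_self (x : V) (b : Bool) (k : ℕ) : x ∈ zigBall x b k := by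
  induction k generalizing b with
  | zero => rw [zigBall_zero]; rfl
  | succ k ih => exact zigBall_subset_succ x b b k (ih b)

theorem isConv_zigBall (x : V) (b : Bool) (k : ℕ) : IsConv (zigBall x b k) := by
  induction k generalizing b with
  | zero => rw [zigBall_zero]; exact isConv_singleton x
  | succ k ih =>
    cases b
    · rw [zigBall_false_succ]; exact isConv_downClosure (ih _)
    · rw [zigBall_true_succ]; exact isConv_upClosure (ih _)

theorem isUpperSet_zigBall (x : V) (k : ℕ) : IsUpperSet (zigBall x true (k + 1)) := by
  rw [zigBall_true_succ]; exact isUpperSet_upClosure _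

theorem isLowerSet_zigBall (x : V) (k : ℕ) : IsLowerSet (zigBall x false (k + 1)) := by
  rw [zigBall_false_succ]; exact isLowerSet_downClosure _

theorem exists_zigIn {X : Set V} (hX : IsChainConnected X) {x w : V} (hx : x ∈ X) (hw : w ∈ X) :
    ∃ k b, w ∈ zigIn X x b k := by
  have h := hX x hx w hw
  clear hw
  induction h with
  | refl => exact ⟨0, true, rfl⟩
  | @tail s t _ hst ih =>
    obtain ⟨k, b, hk⟩ := ih
    rcases hst.2.2 with h | h
    · exact ⟨k + 2, true, ⟨s, zigIn_subset_succ hx b false k hk, h⟩, hst.2.1⟩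
    · exact ⟨k + 2, false, ⟨s, zigIn_subset_succ hx b true k hk, h⟩, hst.2.1⟩

/-! ### Effective domains -/

section Domain

variable {g : V → WithTop ℝ}

theorem mem_dom_iff {V : Type*} {g : V → WithTop ℝ} {y : V} : y ∈ dom g ↔ g y ≠ ⊤ := by
  change g y < ⊤ ↔ _
  exact lt_top_iff_ne_top

theorem IsFracConvex.glb_mem (hg : IsFracConvex g) {p q m : V} (hp : p ∈ dom g) (hq : q ∈ dom g)
    (hm : IsGLB {p, q} m) : m ∈ dom g :=
  mem_dom_iff.2 (hg.up m p q hm (mem_dom_iff.1 hp) (mem_dom_iff.1 hq)).1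

theorem IsFracConvex.lub_mem (hg : IsFracConvex g) {p q m : V} (hp : p ∈ dom g) (hq : q ∈ dom g)
    (hm : IsLUB {p, q} m) : m ∈ dom g :=
  @IsFracConvex.glb_mem V (LConvex.opp V) g hg.opp p q m hp hq (opp_isGLB.2 hm)

/-- An upper bound of `a` and `q` anywhere in the graph is replaced by one in `dom g`, namely the
dominating join for the pair `p`, `q`. -/
theorem IsFracConvex.exists_upper (hg : IsFracConvex g) {p q v a d : V} (hp : p ∈ dom g)
    (hq : q ∈ dom g) (hvp : v ≤ p) (hvq : v ≤ q) (hap : a ≤ p) (had : a ≤ d) (hqd : q ≤ d) :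
    ∃ u ∈ dom g, a ≤ u ∧ q ≤ u := by
  obtain ⟨m, hm⟩ := exists_isGLB hvp hvq
  obtain ⟨m1, m2, -⟩ := isGLB_pair_iff.1 hm
  obtain ⟨-, E, c, h1, -, -, h2⟩ := hg.up m p q hm (mem_dom_iff.1 hp) (mem_dom_iff.1 hq)
  obtain ⟨j, hj⟩ := exists_isLUB hap m1
  obtain ⟨j1, j2, j3⟩ := isLUB_pair_iff.1 hj
  obtain ⟨u, hu, hu1, hu2⟩ := h2 j d j2 (j3 p hap m1) (j3 d had (m2.trans hqd)) hqd
  exact ⟨u, mem_dom_iff.2 (h1 u hu).2.1, j1.trans hu1, hu2⟩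

theorem IsFracConvex.exists_lower (hg : IsFracConvex g) {p q v a d : V} (hp : p ∈ dom g)
    (hq : q ∈ dom g) (hvp : p ≤ v) (hvq : q ≤ v) (hap : p ≤ a) (had : d ≤ a) (hqd : d ≤ q) :
    ∃ u ∈ dom g, u ≤ a ∧ u ≤ q := by
  obtain ⟨u, hu, h1, h2⟩ := @IsFracConvex.exists_upper V (LConvex.opp V) g hg.opp p q v a d hp hq
    (opp_le.2 hvp) (opp_le.2 hvq) (opp_le.2 hap) (opp_le.2 had) (opp_le.2 hqd)
  exact ⟨u, hu, opp_le.1 h1, opp_le.1 h2⟩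

/-- Let the zigzag end with `y ≥ z ≤ w`, and let `t` be the gate of `z` in the ascending ball. Some
`u` in `dom g` is above `t` and `w`. The meet `n` of `y` and `u` is in `dom g` and above `t`, so by
induction it has a short zigzag, which continues up to `u` and down to `w`. -/
theorem IsFracConvex.zigIn_shorten (hg : IsFracConvex g) {x : V} {i : ℕ}
    (ih : ∀ w ∈ zigBall x true (i + 1), w ∈ zigIn (dom g) x false (i + 2) →
      w ∈ zigIn (dom g) x true (i + 1)) {w : V} (hw : w ∈ zigBall x false (i + 2))
    (hw' : w ∈ zigIn (dom g) x true (i + 3)) : w ∈ zigIn (dom g) x false (i + 2) := by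
  obtain ⟨⟨z, ⟨⟨y, hy, hzy⟩, hz⟩, hzw⟩, hwX⟩ := hw'
  obtain ⟨⟨c, hc, hwc⟩, -⟩ := hw
  have hyU : y ∈ zigBall x true (i + 1) := zigIn_subset_zigBall _ _ _ _ hy
  have hyX : y ∈ dom g := hy.2
  obtain ⟨t, ht⟩ := (isConv_zigBall x true (i + 1)).exists_isLeast ⟨y, hyU, hzy⟩
  obtain ⟨u, huX, htu, hwu⟩ := hg.exists_upper hyX hwX hzy hzw (ht.2 ⟨hyU, hzy⟩)
    (ht.2 ⟨hc, hzw.trans hwc⟩) hwc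
  obtain ⟨n, hn⟩ := exists_isGLB hzy (hzw.trans hwu)
  obtain ⟨n1, n2, n3⟩ := isGLB_pair_iff.1 hn
  have hnX := hg.glb_mem hyX huX hn
  have hnU := isUpperSet_zigBall x i (n3 t (ht.2 ⟨hyU, hzy⟩) htu) ht.1.1
  obtain ⟨⟨s, hs, hsn⟩, -⟩ := ih n hnU ⟨⟨y, hy, n1⟩, hnX⟩
  exact ⟨⟨u, ⟨⟨s, hs, hsn.trans n2⟩, huX⟩, hwu⟩, hwX⟩

theorem IsFracConvex.zigIn_of_succ (hg : IsFracConvex g) {x : V} (hx : x ∈ dom g) (j : ℕ)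
    (b : Bool) (w : V) (hw : w ∈ zigBall x b j) (hw' : w ∈ zigIn (dom g) x (!b) (j + 1)) :
    w ∈ zigIn (dom g) x b j := by
  induction j using Nat.twoStepInduction generalizing b w with
  | zero => rwa [zigIn_zero, ← zigBall_zero x b]
  | one =>
    have hwX := zigIn_subset hx _ _ hw'
    cases b
    · obtain ⟨⟨t, ht, h⟩, -⟩ := hw
      exact ⟨⟨t, ht, h⟩, hwX⟩
    · obtain ⟨⟨t, ht, h⟩, -⟩ := hw
      exact ⟨⟨t, ht, h⟩, hwX⟩
  | more i _ ih =>
    cases b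
    · exact hg.zigIn_shorten (ih true) hw hw'
    · have := @IsFracConvex.zigIn_shorten V (LConvex.opp V) g hg.opp x i (by
        simp only [opp_zigBall, opp_zigIn]; exact ih false) w
      simp only [opp_zigBall, opp_zigIn] at this
      exact this hw hw'

/-- Zigzags ending in `dom g` can be chosen inside `dom g`. -/
theorem IsFracConvex.zigIn_of_zigBall (hg : IsFracConvex g) {x : V} (hx : x ∈ dom g) {j : ℕ}
    {b : Bool} {w : V} (hw : w ∈ zigBall x b j) (hwX : w ∈ dom g) : w ∈ zigIn (dom g) x b j := by
  -- A long zigzag is shortened one step at a time; each step flips the last direction, which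
  -- `not^[i] b` records.
  have key : ∀ i, ∀ b' : Bool, (∀ c, i ≠ 0 → w ∈ zigBall x c (j + i)) →
      w ∈ zigIn (dom g) x (not^[i] b) (j + i) → w ∈ zigIn (dom g) x b j := by
    intro i
    induction i with
    | zero => intro _ _ h; exact h
    | succ i ih =>
      intro b' _ h
      have hb (c : Bool) : i ≠ 0 → w ∈ zigBall x c (j + i) := by
        intro hi
        obtain ⟨n, rfl⟩ := Nat.exists_eq_succ_of_ne_zero hi
        exact zigIn_subset_add (Set.mem_univ x) b c j n hw
      refine ih b' hb (hg.zigIn_of_succ hx _ _ w ?_ ?_)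
      · rcases eq_or_ne i 0 with rfl | hi
        · exact hw
        · exact hb _ hi
      · rw [← Function.iterate_succ_apply' not]; exact h
  obtain ⟨K, c, hK⟩ := exists_zigIn hg.chain hx hwX
  have := zigIn_subset_add hx c (not^[K + 1] b) K j hK
  refine key (K + 1) b (fun c _ => zigIn_subset_add (Set.mem_univ x) b c j K hw) ?_
  rwa [show j + (K + 1) = K + (j + 1) by omega]

/-- Take `t` in `dom g` above `w` in the ascending ball, and its gate `v`, in `dom g` by induction.
`IsFracConvex.exists_lower` gives `u` in `dom g` below both `s` and `v`. Then `u ∨ w` is in the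
ascending ball, above `w` and below `s`, so it is `s`. -/
theorem IsFracConvex.gate_mem_step (hg : IsFracConvex g) {x : V} (hx : x ∈ dom g) {i : ℕ}
    (ih : ∀ w t, w ∈ dom g → w ∈ zigBall x true (i + 2) →
      IsGreatest (zigBall x false (i + 1) ∩ Set.Iic w) t → t ∈ dom g) {w s : V}
    (hwX : w ∈ dom g) (hw : w ∈ zigBall x false (i + 3))
    (hs : IsLeast (zigBall x true (i + 2) ∩ Set.Ici w) s) : s ∈ dom g := by
  obtain ⟨⟨t, ht, hwt⟩, -⟩ := hg.zigIn_of_zigBall hx hw hwX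
  have htU : t ∈ zigBall x true (i + 2) := zigIn_subset_zigBall _ _ _ _ ht
  have htX : t ∈ dom g := ht.2
  have hst := hs.2 ⟨htU, hwt⟩
  obtain ⟨⟨d, hd, hdt⟩, -⟩ := id htU
  obtain ⟨v, hv⟩ := (isConv_zigBall x false (i + 1)).exists_isGreatest ⟨d, hd, hdt⟩
  have hvX := ih t v htX htU hv
  obtain ⟨n, hn⟩ := exists_isLUB hv.1.2 hwt
  obtain ⟨n1, n2, -⟩ := isLUB_pair_iff.1 hn
  have hnU : n ∈ zigBall x true (i + 2) := ⟨⟨v, hv.1.1, n1⟩, trivial⟩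
  obtain ⟨⟨v₀, hv₀, hvs⟩, -⟩ := hs.1.1
  obtain ⟨u, huX, hus, huv⟩ := hg.exists_lower hwX hvX n2 n1 hs.1.2 hvs (hv.2 ⟨hv₀, hvs.trans hst⟩)
  obtain ⟨r, hr⟩ := exists_isLUB hus hs.1.2
  obtain ⟨r1, r2, r3⟩ := isLUB_pair_iff.1 hr
  have huD := isLowerSet_zigBall x i huv hv.1.1
  have hrU : r ∈ zigBall x true (i + 2) := ⟨⟨u, huD, r1⟩, trivial⟩
  rw [le_antisymm (hs.2 ⟨hrU, r2⟩) (r3 s hus hs.1.2)]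
  exact hg.lub_mem huX hwX hr

theorem IsFracConvex.gate_mem_aux (hg : IsFracConvex g) {x : V} (hx : x ∈ dom g) (k : ℕ) :
    (∀ w t, w ∈ dom g → w ∈ zigBall x false (k + 1) →
      IsLeast (zigBall x true k ∩ Set.Ici w) t → t ∈ dom g) ∧
    (∀ w t, w ∈ dom g → w ∈ zigBall x true (k + 1) →
      IsGreatest (zigBall x false k ∩ Set.Iic w) t → t ∈ dom g) := by
  induction k using Nat.twoStepInduction with
  | zero =>
    simp only [zigBall_zero]
    exact ⟨fun w t _ _ h => (show t = x from h.1.1) ▸ hx,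
      fun w t _ _ h => (show t = x from h.1.1) ▸ hx⟩
  | one =>
    have h1 : zigBall x true 1 = Set.Ici x := by
      rw [zigBall_true_succ, zigBall_zero]; ext; simp [upClosure]
    have h2 : zigBall x false 1 = Set.Iic x := by
      rw [zigBall_false_succ, zigBall_zero]; ext; simp [downClosure]
    rw [h1, h2]
    exact ⟨fun w t hw _ h => hg.lub_mem hx hw (isLUB_pair_iff.2
        ⟨h.1.1, h.1.2, fun c h3 h4 => h.2 ⟨h3, h4⟩⟩),
      fun w t hw _ h => hg.glb_mem hx hw (isGLB_pair_iff.2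
        ⟨h.1.1, h.1.2, fun c h3 h4 => h.2 ⟨h3, h4⟩⟩)⟩
  | more i _ ih =>
    refine ⟨fun w t hw hw' ht => hg.gate_mem_step hx ih.2 hw hw' ht, fun w t hw hw' ht => ?_⟩
    have := @IsFracConvex.gate_mem_step V (LConvex.opp V) g hg.opp x hx i (by
      simp only [opp_zigBall, opp_Iic, opp_isGreatest]; exact ih.1) w t hw
    simp only [opp_zigBall, opp_Ici, opp_isLeast] at this
    exact this hw' ht

theorem IsFracConvex.gate_mem (hg : IsFracConvex g) {x : V} (hx : x ∈ dom g) {k : ℕ} {w t : V}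
    (hw : w ∈ dom g) (hw' : w ∈ zigBall x false (k + 1))
    (ht : IsLeast (zigBall x true k ∩ Set.Ici w) t) : t ∈ dom g :=
  (hg.gate_mem_aux hx k).1 w t hw hw' ht

end Domain

end Zigzag

/-! ## Local and global minimality -/

section LocalGlobal

open OrientedModularGraph

variable {V : Type*} [OrientedModularGraph V] {g : V → WithTop ℝ}

theorem untopD_le {a b : WithTop ℝ} (h : a ≤ b) (hb : b ≠ ⊤) : a.untopD 0 ≤ b.untopD 0 := by
  lift b to ℝ using hb
  lift a to ℝ using ne_top_of_le_ne_top WithTop.coe_ne_top h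
  exact_mod_cast h

theorem untopD_lt {a b : WithTop ℝ} (h : a < b) (hb : b ≠ ⊤) : a.untopD 0 < b.untopD 0 := by
  lift b to ℝ using hb
  lift a to ℝ using h.ne_top
  exact_mod_cast h

/-- `g` does not decrease from the gate of `w` to `w`, for `w` closer to `x` than `n`. -/
def GateMono (g : V → WithTop ℝ) (x : V) (n : ℕ) : Prop :=
  ∀ k w t, dst x w < n → w ∈ dom g → w ∈ zigBall x false (k + 1) →
    IsLeast (zigBall x true k ∩ Set.Ici w) t → g t ≤ g w

theorem opp_gateMono {x : V} {n : ℕ} : @GateMono V (LConvex.opp V) g x n ↔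
    ∀ k w t, dst x w < n → w ∈ dom g → w ∈ zigBall x true (k + 1) →
      IsGreatest (zigBall x false k ∩ Set.Iic w) t → g t ≤ g w := by
  unfold GateMono
  simp only [opp_zigBall, opp_Ici, opp_isLeast]
  rfl

/-- Suppose `g t > g w`, and let `v` be the gate of `t`. Then `t = w ∨ v`, and the dual inequality
reads `g t + ∑ c u * g u ≤ g w + g v`. Every `u ≠ w` is closer to `x` than `w`, and its gate has
gate `v`, so `g v ≤ g u` by induction; likewise `g v ≤ g t`. If `g v ≤ g w`, the sum is at least `g
v`, giving `g t ≤ g w`. If `g w < g v`, the sum exceeds `g w`, giving `g t < g v`. Both are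
impossible. -/
theorem IsFracConvex.gateMono_succ (hg : IsFracConvex g) {x : V} (hx : x ∈ dom g)
    (hloc : ∀ y, y ≤ x ∨ x ≤ y → g x ≤ g y) {n : ℕ} (hd : GateMono g x n)
    (hu : @GateMono V (LConvex.opp V) g x n) : GateMono g x (n + 1) := by
  rw [opp_gateMono] at hu
  rintro (_ | i) w t hwn hwX hw ht
  · obtain rfl : t = x := ht.1.1
    exact hloc w (Or.inl ht.1.2)
  by_contra! hlt
  have htX := hg.gate_mem hx hwX hw ht
  obtain ⟨htU, hwt⟩ := ht.1
  obtain ⟨⟨d, hdD, hdt⟩, -⟩ := id htU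
  obtain ⟨v, hv⟩ := (isConv_zigBall x false i).exists_isGreatest ⟨d, hdD, hdt⟩
  obtain ⟨hvD, hvt⟩ := hv.1
  have hvX : v ∈ dom g := (hg.gate_mem_aux hx i).2 t v htX htU hv
  have mkU {y z : V} (hy : y ∈ zigBall x false i) (h : y ≤ z) : z ∈ zigBall x true (i + 1) :=
    ⟨⟨y, hy, h⟩, trivial⟩
  have hwU : w ∉ zigBall x true (i + 1) := by
    intro h
    have : t = w := le_antisymm (ht.2 ⟨h, Set.self_mem_Ici⟩) hwt
    exact hlt.ne (by rw [this])
  have htw : t ≠ w := fun h => hlt.ne (by rw [h])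
  have hwv : ¬ w ≤ v := by
    intro h
    cases i with
    | zero =>
      rw [zigBall_zero] at hvD
      obtain rfl : v = x := hvD
      have := ht.2 ⟨mkU (by rw [zigBall_zero]; rfl) le_rfl, h⟩
      exact (hloc w (Or.inl h)).not_gt ((le_antisymm this hvt) ▸ hlt)
    | succ i => exact hwU (mkU (isLowerSet_zigBall x i h hvD) le_rfl)
  -- joins of elements above `D_i` with elements above `w`, below `t`, equal `t`
  have lub {a b y : V} (hy : y ∈ zigBall x false i) (hya : y ≤ a) (hat : a ≤ t) (hwb : w ≤ b)
      (hbt : b ≤ t) : IsLUB {a, b} t :=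
    isLUB_pair_iff.2 ⟨hat, hbt, fun c h1 h2 => ht.2 ⟨mkU hy (hya.trans h1), hwb.trans h2⟩⟩
  have hlub : IsLUB {w, v} t := isLUB_pair_comm (lub hvD le_rfl hvt le_rfl hwt)
  obtain ⟨-, E, c, hE, hsum, hineq, hend⟩ := hg.meets hlub (mem_dom_iff.1 hwX) (mem_dom_iff.1 hvX)
  -- distances
  have b1 : Btw w t x := (isConv_zigBall x true (i + 1)).dst_gate ht (mem_zigBall_self _ _ _)
  have b2 : Btw t v x := (isConv_zigBall x false i).dst_gate' hv (mem_zigBall_self _ _ _)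
  have b3 : Btw w t v := btw_of_isLUB hlub
  have c1 := dst_comm w x
  have c2 := dst_comm t x
  have c3 := dst_comm v x
  have c4 := dst_comm t w
  have c5 := dst_comm t v
  have c6 := dst_comm w v
  have n1 : dst t w ≠ 0 := fun h => htw (dst_eq_zero.1 h)
  unfold Btw at b1 b2 b3
  have htn : dst x t < n := by omega
  have hvt' : g v ≤ g t := hu i t v htn htX htU hv
  have key : ∀ u ∈ E, u ≠ w → g v ≤ g u := by
    intro u huE hne
    obtain ⟨-, hutop, b, a, hbt, hwb, hat, hva, hu'⟩ := hE u huE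
    obtain ⟨hub, hua, hu3⟩ := isGLB_pair_iff.1 hu'
    have huX := mem_dom_iff.2 hutop
    have haU := mkU hvD hva
    have b4 : Btw w u v := @btw_of_join V (LConvex.opp V) w v t b a u (opp_isGLB.2 hlub) (opp_le.2 hbt)
      (opp_le.2 hwb) (opp_le.2 hat) (opp_le.2 hva) (opp_isLUB.2 hu')
    obtain ⟨a', ha'⟩ := (isConv_zigBall x true (i + 1)).exists_isLeast ⟨a, haU, hua⟩
    have haa' := ha'.2 ⟨haU, hua⟩
    obtain ⟨⟨v', hv'D, hv'a⟩, -⟩ := id ha'.1.1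
    have hba : IsGLB {b, a'} u := isGLB_pair_iff.2 ⟨hub, ha'.1.2, fun z h1 h2 =>
      hu3 z h1 (h2.trans haa')⟩
    -- Both `a` and the gate `a'` of `u` meet `b` in `u` and join with it to `t`; equal ranks give
    -- `a = a'`.
    have e1 := dst_transpose hu' (isLUB_pair_comm (lub hvD hva hat hwb hbt))
    have e2 := dst_transpose hba (isLUB_pair_comm (lub hv'D hv'a (haa'.trans hat) hwb hbt))
    obtain rfl := eq_of_le_of_dst ha'.1.2 haa' (by omega)
    have hva' : IsGreatest (zigBall x false i ∩ Set.Iic a') v :=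
      ⟨⟨hvD, hva⟩, fun z hz => hv.2 ⟨hz.1, hz.2.trans hat⟩⟩
    have huD : u ∈ zigBall x false (i + 2) := ⟨⟨a', haU, hua⟩, trivial⟩
    have t1 := dst_triangle x v u
    have t2 := dst_triangle x v a'
    have t3 := btw_of_le hva hat
    have c7 := dst_comm u v
    have n2 : dst w u ≠ 0 := fun h => hne (dst_eq_zero.1 h).symm
    unfold Btw at b4 t3
    have haX := hg.gate_mem hx huX huD ha'
    exact (hu i a' v (by omega) haX haU hva').trans (hd (i + 1) u a' (by omega) huX huD ha')
  -- This term lies below `v`, so it differs from `w` and makes the second case strict.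
  obtain ⟨u₁, hu₁, -, hu₁v⟩ := hend t v le_rfl hwt hvt le_rfl
  have hu₁w : u₁ ≠ w := fun h => hwv (h ▸ hu₁v)
  have htr := untopD_lt hlt (mem_dom_iff.1 htX)
  have hvr := untopD_le hvt' (mem_dom_iff.1 htX)
  have hkey : ∀ u ∈ E, u ≠ w → (g v).untopD 0 ≤ (g u).untopD 0 := fun u hu h =>
    untopD_le (key u hu h) (hE u hu).2.1
  rcases le_or_gt ((g v).untopD 0) ((g w).untopD 0) with h | h
  · have : ∑ u ∈ E, c u * (g v).untopD 0 ≤ ∑ u ∈ E, c u * (g u).untopD 0 := by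
      refine Finset.sum_le_sum fun u hu => mul_le_mul_of_nonneg_left ?_ (hE u hu).1.le
      by_cases huw : u = w
      · rw [huw]; exact h
      · exact hkey u hu huw
    rw [← Finset.sum_mul, hsum] at this
    linarith
  · have : ∑ u ∈ E, c u * (g w).untopD 0 < ∑ u ∈ E, c u * (g u).untopD 0 := by
      refine Finset.sum_lt_sum (fun u hu => mul_le_mul_of_nonneg_left ?_ (hE u hu).1.le)
        ⟨u₁, hu₁, mul_lt_mul_of_pos_left (h.trans_le (hkey u₁ hu₁ hu₁w)) (hE u₁ hu₁).1⟩
      by_cases huw : u = w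
      · rw [huw]
      · exact h.le.trans (hkey u hu huw)
    rw [← Finset.sum_mul, hsum] at this
    linarith

theorem opp_local {x : V} (hloc : ∀ y, y ≤ x ∨ x ≤ y → g x ≤ g y) :
    ∀ y, (oppOrder V).le y x ∨ (oppOrder V).le x y → g x ≤ g y :=
  fun y h => hloc y (h.symm.imp opp_le.1 opp_le.1)

theorem IsFracConvex.gateMono (hg : IsFracConvex g) {x : V} (hx : x ∈ dom g)
    (hloc : ∀ y, y ≤ x ∨ x ≤ y → g x ≤ g y) (n : ℕ) :
    GateMono g x n ∧ @GateMono V (LConvex.opp V) g x n := by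
  induction n with
  | zero =>
    exact ⟨fun k w t h => absurd h (by simp), fun k w t h => absurd h (by simp)⟩
  | succ n ih =>
    exact ⟨hg.gateMono_succ hx hloc ih.1 ih.2,
      @IsFracConvex.gateMono_succ V (LConvex.opp V) g hg.opp x hx (opp_local hloc) n ih.2 ih.1⟩

/-- Local minimizers are global minimizers. -/
theorem IsFracConvex.le_of_local (hg : IsFracConvex g) {x : V} (hx : x ∈ dom g)
    (hloc : ∀ y, y ≤ x ∨ x ≤ y → g x ≤ g y) {w : V} (hw : w ∈ dom g) : g x ≤ g w := by
  have key : ∀ k b w, w ∈ dom g → w ∈ zigBall x b k → g x ≤ g w := by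
    intro k
    induction k with
    | zero =>
      intro b w _ hw
      rw [zigBall_zero] at hw
      exact (show w = x from hw) ▸ le_rfl
    | succ k ih =>
      intro b w hwX hw
      obtain ⟨h1, h2⟩ := hg.gateMono hx hloc (dst x w + 1)
      rw [opp_gateMono] at h2
      cases b
      · obtain ⟨⟨d, hd, hwd⟩, -⟩ := id hw
        obtain ⟨t, ht⟩ := (isConv_zigBall x true k).exists_isLeast ⟨d, hd, hwd⟩
        exact (ih true t ((hg.gate_mem_aux hx k).1 w t hwX hw ht) ht.1.1).trans
          (h1 k w t (Nat.lt_succ_self _) hwX hw ht)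
      · obtain ⟨⟨d, hd, hwd⟩, -⟩ := id hw
        obtain ⟨t, ht⟩ := (isConv_zigBall x false k).exists_isGreatest ⟨d, hd, hwd⟩
        exact (ih false t ((hg.gate_mem_aux hx k).2 w t hwX hw ht) ht.1.1).trans
          (h2 k w t (Nat.lt_succ_self _) hwX hw ht)
  obtain ⟨k, b, h⟩ := exists_zigIn hg.chain hx hw
  exact key k b w hw (zigIn_subset_zigBall _ _ _ _ h)

end LocalGlobal

/-! ## Steepest descent -/

section Descent

open OrientedModularGraph

variable {V : Type*} [OrientedModularGraph V] {g : V → WithTop ℝ}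

open Classical in
/-- The function `g` on `Z`, and `∞` elsewhere. -/
noncomputable def restrictTo (g : V → WithTop ℝ) (Z : Set V) (y : V) : WithTop ℝ :=
  if y ∈ Z then g y else ⊤

theorem restrictTo_of_mem {V : Type*} {g : V → WithTop ℝ} {Z : Set V} {y : V} (hy : y ∈ Z) :
    restrictTo g Z y = g y := if_pos hy

theorem restrictTo_ne_top {V : Type*} {g : V → WithTop ℝ} {Z : Set V} {y : V}
    (h : restrictTo g Z y ≠ ⊤) : y ∈ Z ∧ g y ≠ ⊤ := by
  by_cases hy : y ∈ Z
  · rw [restrictTo_of_mem hy] at h; exact ⟨hy, h⟩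
  · exact absurd (if_neg hy) h

theorem dom_restrictTo {V : Type*} {g : V → WithTop ℝ} {Z : Set V} :
    dom (restrictTo g Z) = dom g ∩ Z := by
  ext y
  rw [mem_dom_iff]
  constructor
  · intro h
    exact ⟨mem_dom_iff.2 (restrictTo_ne_top h).2, (restrictTo_ne_top h).1⟩
  · rintro ⟨h, hy⟩
    rw [restrictTo_of_mem hy]
    exact mem_dom_iff.1 h

/-- The meet and all joins involved lie on geodesics from `p` to `q`, so convexity of `Z` keeps them
in `Z`. -/
theorem HasFracJoin.restrictTo (hg : HasFracJoin g) {Z : Set V} (hZ : IsConv Z) :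
    HasFracJoin (restrictTo g Z) := by
  intro m p q hm hp hq
  obtain ⟨hpZ, hp⟩ := restrictTo_ne_top hp
  obtain ⟨hqZ, hq⟩ := restrictTo_ne_top hq
  obtain ⟨hgm, E, c, hE, hsum, hineq, hend⟩ := hg m p q hm hp hq
  have hmZ := hZ p hpZ q hqZ m (btw_of_isGLB hm)
  have hEZ : ∀ u ∈ E, u ∈ Z := fun u hu => by
    obtain ⟨-, -, a, b, a1, a2, b1, b2, h, -⟩ := hE u hu
    exact hZ p hpZ q hqZ u (btw_of_join hm a1 a2 b1 b2 h)
  refine ⟨by rwa [restrictTo_of_mem hmZ], E, c, fun u hu => ?_, hsum, ?_, hend⟩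
  · rw [restrictTo_of_mem (hEZ u hu)]
    exact hE u hu
  · rw [restrictTo_of_mem hmZ, restrictTo_of_mem hpZ, restrictTo_of_mem hqZ,
      Finset.sum_congr rfl fun u hu => by rw [restrictTo_of_mem (hEZ u hu)]]
    exact hineq

theorem IsFracConvex.restrictTo (hg : IsFracConvex g) {Z : Set V} (hZ : IsConv Z)
    (hc : IsChainConnected (dom g ∩ Z)) : IsFracConvex (restrictTo g Z) where
  up := hg.up.restrictTo hZ
  down := @HasFracJoin.restrictTo V (LConvex.opp V) g hg.down Z hZ
  chain := by rwa [dom_restrictTo]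

theorem IsFracConvex.isChainConnected_zigBall (hg : IsFracConvex g) {x : V} (hx : x ∈ dom g)
    (b : Bool) (k : ℕ) : IsChainConnected (dom g ∩ zigBall x b k) := by
  have key : ∀ k b w, w ∈ zigIn (dom g) x b k → Relation.ReflTransGen (fun y z =>
      y ∈ dom g ∩ zigBall x b k ∧ z ∈ dom g ∩ zigBall x b k ∧ (y ≤ z ∨ z ≤ y)) x w := by
    intro k
    induction k with
    | zero =>
      intro b w hw
      rw [zigIn_zero] at hw
      rw [show w = x from hw]
    | succ k ih =>
      intro b w hw
      have hw' : w ∈ dom g ∩ zigBall x b (k + 1) :=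
        ⟨zigIn_subset hx _ _ hw, zigIn_subset_zigBall _ _ _ _ hw⟩
      obtain ⟨t, ht, htw⟩ : ∃ t ∈ zigIn (dom g) x (!b) k, t ≤ w ∨ w ≤ t := by
        cases b
        · obtain ⟨⟨t, ht, h⟩, -⟩ := hw; exact ⟨t, ht, Or.inr h⟩
        · obtain ⟨⟨t, ht, h⟩, -⟩ := hw; exact ⟨t, ht, Or.inl h⟩
      have hsub := zigBall_subset_succ x (!b) b k
      refine Relation.ReflTransGen.tail (Relation.ReflTransGen.mono (fun y z h => ?_) _ _
        (ih (!b) t ht)) ⟨⟨zigIn_subset hx _ _ ht, hsub (zigIn_subset_zigBall _ _ _ _ ht)⟩, hw', htw⟩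
      exact ⟨⟨h.1.1, hsub h.1.2⟩, ⟨h.2.1.1, hsub h.2.1.2⟩, h.2.2⟩
  intro p hp q hq
  have hp' := key k b p (hg.zigIn_of_zigBall hx hp.2 hp.1)
  have hq' := key k b q (hg.zigIn_of_zigBall hx hq.2 hq.1)
  refine Relation.ReflTransGen.trans ?_ hq'
  have := Relation.reflTransGen_swap.2 hp'
  exact Relation.ReflTransGen.mono (fun y z h => ⟨h.2.1, h.1, h.2.2.symm⟩) _ _ this

/-- A descending step from a minimizer over an ascending zigzag ball minimizes over the next
zigzag ball. -/
theorem IsFracConvex.descend (hg : IsFracConvex g) {x s s' : V} (hx : x ∈ dom g) (hs : s ∈ dom g)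
    {i : ℕ} (hsU : s ∈ zigBall x true (i + 1)) (hmin : ∀ y ∈ zigBall x true (i + 1), g s ≤ g y)
    (hle : s' ≤ s) (hmin' : ∀ y, y ≤ s → g s' ≤ g y) {w : V}
    (hw : w ∈ zigBall x false (i + 2)) : g s' ≤ g w := by
  by_cases hwX : g w = ⊤
  · rw [hwX]; exact le_top
  set Z := zigBall x false (i + 2) with hZ
  have hs'Z : s' ∈ Z := ⟨⟨s, hsU, hle⟩, trivial⟩
  have hs'X : s' ∈ dom g := (hmin' s le_rfl).trans_lt hs
  have hgZ : IsFracConvex (LConvex.restrictTo g Z) :=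
    hg.restrictTo (isConv_zigBall _ _ _) (hg.isChainConnected_zigBall hx _ _)
  have hloc : ∀ y, y ≤ s' ∨ s' ≤ y → LConvex.restrictTo g Z s' ≤ LConvex.restrictTo g Z y := by
    intro y hy
    by_cases hyX : LConvex.restrictTo g Z y = ⊤
    · rw [hyX]; exact le_top
    obtain ⟨hyZ, hyX⟩ := restrictTo_ne_top hyX
    rw [restrictTo_of_mem hs'Z, restrictTo_of_mem hyZ]
    rcases hy with hy | hy
    · exact hmin' y (hy.trans hle)
    -- Submodularity for `s` and `y`: once all joins lie in the ball minimized by `s`, their average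
    -- is at least `g s`, which leaves `g m ≤ g y`; and `m ≤ s` gives `g s' ≤ g m`.
    obtain ⟨m, hm⟩ := exists_isGLB hle hy
    obtain ⟨m1, m2, m3⟩ := isGLB_pair_iff.1 hm
    obtain ⟨hgm, E, c, hE, hsum, hineq, -⟩ := hg.up m s y hm (mem_dom_iff.1 hs) hyX
    obtain ⟨t, ht⟩ := (isConv_zigBall x true (i + 1)).exists_isLeast ⟨s, hsU, hle⟩
    have hts := ht.2 ⟨hsU, hle⟩
    obtain ⟨⟨d, hd, hyd⟩, -⟩ := id hyZ
    have htd := ht.2 ⟨hd, hy.trans hyd⟩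
    have hEs : ∀ u ∈ E, (g s).untopD 0 ≤ (g u).untopD 0 := by
      intro u hu
      obtain ⟨-, hutop, a, b, a1, a2, b1, b2, h, hmax⟩ := hE u hu
      refine untopD_le (hmin u ?_) hutop
      obtain ⟨hau, hbu, -⟩ := isLUB_pair_iff.1 h
      obtain ⟨j, hj⟩ := exists_isLUB a2 hts
      obtain ⟨j1, j2, j3⟩ := isLUB_pair_iff.1 hj
      -- Pairwise bounds `u`, `d`, `s` for `a`, `b`, `t` show that `a` can be enlarged to `a ∨ t`;
      -- maximality of `u` then puts `u` above the gate `t`, hence in the ball.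
      obtain ⟨e, e1, e2, e3⟩ := exists_upper_bound hau hbu (b2.trans hyd) htd a2 hts
      obtain ⟨r, hr⟩ := exists_isLUB (j3 e e1 e3) e2
      rw [← hmax j b r j1 (j3 s a2 hts) le_rfl b2 hr]
      exact isUpperSet_zigBall x i (j2.trans (isLUB_pair_iff.1 hr).1) ht.1.1
    have h1 : ∑ u ∈ E, c u * (g s).untopD 0 ≤ ∑ u ∈ E, c u * (g u).untopD 0 :=
      Finset.sum_le_sum fun u hu => mul_le_mul_of_nonneg_left (hEs u hu) (hE u hu).1.le
    rw [← Finset.sum_mul, hsum] at h1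
    have h2 : (g m).untopD 0 ≤ (g y).untopD 0 := by linarith
    refine (hmin' m m1).trans ?_
    lift g m to ℝ using hgm with gm
    lift g y to ℝ using hyX with gy
    exact_mod_cast h2
  have := hgZ.le_of_local (x := s') (w := w) (by rw [dom_restrictTo]; exact ⟨hs'X, hs'Z⟩) hloc
    (by rw [dom_restrictTo]; exact ⟨mem_dom_iff.2 hwX, hw⟩)
  rwa [restrictTo_of_mem hs'Z, restrictTo_of_mem hw] at this

/-- Vertices at distance `n` in `Γ^Δ` are reached by zigzags with `n + 1` steps. -/
theorem mem_zigBall_of_walk {x y : V} (w : (deltaGraph V).Walk x y) (b : Bool) :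
    y ∈ zigBall x b (w.length + 1) := by
  have key : ∀ n : ℕ, ∀ y, (∃ w : (deltaGraph V).Walk y x, w.length = n) → ∀ b,
      y ∈ zigBall x b (n + 1) := by
    intro n
    induction n with
    | zero =>
      rintro y ⟨w, hw⟩ b
      rw [SimpleGraph.Walk.eq_of_length_eq_zero hw]
      exact mem_zigBall_self _ _ _
    | succ n ih =>
      rintro y ⟨w, hw⟩ b
      cases w with
      | nil => simp at hw
      | @cons _ z _ hadj w =>
        have hz := ih z ⟨w, by simpa using hw⟩
        -- An edge needs two comparisons, but the ball around `x` containing `z` is already an upper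
        -- (or lower) set, which absorbs one of them. The initial radius `1` ensures this from the
        -- start.
        have hbd : (∃ m, m ≤ y ∧ m ≤ z) ∧ ∃ j, y ≤ j ∧ z ≤ j := by
          rcases hadj with h | ⟨-, ⟨m, hm⟩, j, hj⟩
          · rcases ((admissible (V := V)).adj_iff y z).1 h with h | h
            · exact ⟨⟨z, le_of_arc h, le_rfl⟩, y, le_rfl, le_of_arc h⟩
            · exact ⟨⟨y, le_rfl, le_of_arc h⟩, z, le_of_arc h, le_rfl⟩
          · obtain ⟨m1, m2, -⟩ := isGLB_pair_iff.1 hm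
            obtain ⟨j1, j2, -⟩ := isLUB_pair_iff.1 hj
            exact ⟨⟨m, m1, m2⟩, j, j1, j2⟩
        obtain ⟨⟨m, m1, m2⟩, j, j1, j2⟩ := hbd
        cases b
        · exact ⟨⟨j, isUpperSet_zigBall x n j2 (hz true), j1⟩, trivial⟩
        · exact ⟨⟨m, isLowerSet_zigBall x n m2 (hz false), m1⟩, trivial⟩
  exact key w.length y ⟨w.reverse, by simp⟩ b

theorem deltaGraph_connected (V : Type*) [OrientedModularGraph V] : (deltaGraph V).Connected :=
  (modular (V := V)).connected.mono fun _ _ h => Or.inl h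

theorem mem_zigBall_of_deltaDist {x o : V} {n : ℕ} (h : (deltaGraph V).dist x o ≤ n) (b : Bool) :
    o ∈ zigBall x b (n + 1) := by
  obtain ⟨w, hw⟩ := (deltaGraph_connected V).exists_walk_length_eq_dist x o
  rw [← hw] at h
  rcases h.eq_or_lt with rfl | h
  · exact mem_zigBall_of_walk w b
  · obtain ⟨k, rfl⟩ := Nat.exists_eq_add_of_lt h
    have := zigIn_subset_add (Set.mem_univ x) b b (w.length + 1) k (mem_zigBall_of_walk w b)
    rwa [show w.length + 1 + (k + 1) = w.length + k + 1 + 1 by omega] at this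

/-- After `i + 1` iterations of steepest descent, the current point minimizes `g` over a zigzag ball
of radius `i + 1` around the initial point. -/
theorem IsFracConvex.run_min (hg : IsFracConvex g) {x : V} (hx : x ∈ dom g) {N : ℕ} {s : ℕ → V}
    (hs : IsSDARun g x N s) (i : ℕ) (hi : i < N) : ∃ b, s (i + 1) ∈ dom g ∧
      s (i + 1) ∈ zigBall x b (i + 1) ∧ ∀ y ∈ zigBall x b (i + 1), g (s (i + 1)) ≤ g y := by
  obtain ⟨h0, hrun⟩ := hs
  induction i with
  | zero =>
    obtain ⟨⟨h1, h2⟩, -⟩ := hrun 0 hi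
    rw [h0] at h1 h2
    have hd : s 1 ∈ dom g := (h2 x (Or.inl Set.self_mem_Iic)).trans_lt hx
    rcases h1 with h1 | h1
    · refine ⟨false, hd, ⟨⟨x, rfl, h1⟩, trivial⟩, ?_⟩
      rintro y ⟨⟨t, ht, hy⟩, -⟩
      exact h2 y (Or.inl ((show t = x from ht) ▸ hy))
    · refine ⟨true, hd, ⟨⟨x, rfl, h1⟩, trivial⟩, ?_⟩
      rintro y ⟨⟨t, ht, hy⟩, -⟩
      exact h2 y (Or.inr ((show t = x from ht) ▸ hy))
  | succ i ih =>
    obtain ⟨b, hd, hmem, hmin⟩ := ih (by omega)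
    obtain ⟨⟨h1, h2⟩, h3⟩ := hrun (i + 1) hi
    have hle := h2 (s (i + 1)) (Or.inl Set.self_mem_Iic)
    have hd' : s (i + 2) ∈ dom g := hle.trans_lt hd
    have hlt := lt_of_le_of_ne hle h3.symm
    cases b
    -- A descending step would stay in this lower set, where the current value is already least; the
    -- strict decrease forces an ascending step.
    · have hge : s (i + 1) ≤ s (i + 2) := h1.resolve_left fun h =>
        (hmin _ (isLowerSet_zigBall x i h hmem)).not_gt hlt
      refine ⟨true, hd', ⟨⟨_, hmem, hge⟩, trivial⟩, fun y hy => ?_⟩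
      have := @IsFracConvex.descend V (LConvex.opp V) g hg.opp x (s (i + 1)) (s (i + 2)) hx hd i
      simp only [opp_zigBall, opp_le] at this
      exact this hmem hmin hge (fun z hz => h2 z (Or.inr hz)) hy
    · have hge : s (i + 2) ≤ s (i + 1) := h1.resolve_right fun h =>
        (hmin _ (isUpperSet_zigBall x i h hmem)).not_gt hlt
      exact ⟨false, hd', ⟨⟨_, hmem, hge⟩, trivial⟩, fun y hy =>
        hg.descend hx hd hmem hmin hge (fun z hz => h2 z (Or.inl hz)) hy⟩

/-- The number of iterations of steepest descent exceeds the `Γ^Δ`-distance to any minimizer by at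
most one. -/
theorem IsFracConvex.run_length_le (hg : IsFracConvex g) {x o : V} (hx : x ∈ dom g)
    (ho : o ∈ opt g) {N : ℕ} {s : ℕ → V} (hs : IsSDARun g x N s) :
    N ≤ (deltaGraph V).dist x o + 1 := by
  by_contra! hN
  obtain ⟨k, rfl⟩ := Nat.exists_eq_add_of_lt hN
  set d := (deltaGraph V).dist x o
  -- Both balls of radius `d + k + 1` contain `o`, whichever `b` occurs, so `s (d + k + 1)` is
  -- already optimal, contradicting the strict decrease in the next iteration.
  obtain ⟨b, -, -, hmin⟩ := hg.run_min hx hs (d + k) (by omega)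
  have h1 := hmin o (mem_zigBall_of_deltaDist (Nat.le_add_right _ _) b)
  obtain ⟨⟨-, h2⟩, h3⟩ := hs.2 (d + k + 1) (by omega)
  exact h3 (le_antisymm (h1.trans (ho _)) (h2 _ (Or.inl Set.self_mem_Iic)))

end Descent

end LConvex

theorem mainTheorem10 {V : Type*} [LConvex.OrientedModularGraph V]
    (hV : LConvex.IsWellOriented V) (g : V → WithTop ℝ) (hg : LConvex.IsLConvex g)
    (hopt : (LConvex.opt g).Nonempty) (x : V) (hx : x ∈ LConvex.dom g)
    (N : ℕ) (s : ℕ → V) (hs : LConvex.IsSDARun g x N s) :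
    N ≤ LConvex.deltaDist x (LConvex.opt g) + 2 := by
  obtain ⟨o, ho, hd⟩ := Nat.sInf_mem (hopt.image ((LConvex.deltaGraph V).dist x))
  have h := hg.isFracConvex.run_length_le hx ho hs
  rw [hd] at h
  -- The argument gives the distance plus one, which is stronger than required.
  exact h.trans (Nat.le_succ _)
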